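/- Let $1\le k\le n$ be integers, let $q\le 1$ be real, and let $M\ge 0$, $h_0>0$, $K\ge 0$. There is a constant $C$, depending only on $n,k,q,M,h_0,K$, such that the following holds. Let $\Omega\subset\mathbb R^n$ be a nonempty bounded open set, let $g\in C^4(\Omega)\cap C^2(\overline\Omega)$ with $\sup_\Omega|g|\le M$ and $\sup_\Omega|Dg|\le M$, and let $H\in C^2(\Omega\times\mathbb R)$ be such that on $\Omega\times[\inf_\Omega g,\ \sup_\Omega g]$ we have $H\ge h_0$ and $H$ and its first and second derivatives are bounded in norm by $K$. (Here $g\in C^2(\overline\Omega)$ means that $g$ is $C^2$ in $\Omega$ and that $g$, $Dg$, $D^2g$ extend continuously to $\overline\Omega$.) Let $\lambda=(\lambda_1,\dots,\lambda_n)$ be the principal curvatures of the graph $\{(x,g(x)) : x\in\Omega\}\subset\mathbb R^{n+1}$ with respect to the upward unit normal, i.e. the eigenvalues of $(\delta_{ij}+g_ig_j)^{-1}\,\big(g_{ij}/\sqrt{1+|Dg|^2}\big)$, and let $|A|=(\lambda_1^2+\dots+\lambda_n^2)^{1/2}$ be the norm of its second fundamental form, extended to $\partial\Omega$ through the boundary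 values of $Dg$ and $D^2g$. Let $\sigma_l$ be the $l$-th elementary symmetric polynomial. Suppose that $g$ is an admissible solution, i.e. that at every point of $\Omega$ we have $\sigma_l(\lambda)>0$ for $l=1,\dots,k$, and $$\sigma_k(\lambda)=\frac{H(x,g)}{(1+|Dg|^2)^{q/2}}\quad\text{in }\Omega .$$ Then $\sup_\Omega|A|$ and $\sup_{\partial\Omega}|A|$ are finite and $$\sup_{\Omega}|A|\le C\Big(1+\sup_{\partial\Omega}|A|\Big).$$ -/

import Mathlib

open Set

noncomputable section

namespace CurvatureGraph

/-- Euclidean space of dimension `n`. -/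
abbrev E (n : ℕ) : Type := EuclideanSpace ℝ (Fin n)

/-- The `i`-th vector of the standard basis. -/
def e {n : ℕ} (i : Fin n) : E n := EuclideanSpace.single i 1

/-- `g ∈ C²(closure Ω)`: `g` is twice continuously differentiable in the open set `Ω`, and `g`, its
first derivative and its second derivative extend continuously to `closure Ω`. The extensions of the
derivatives are named: `Dg` and `D2g` are the derivatives in `Ω` and their continuous boundary values
on the boundary of `Ω`. -/
structure IsC2OnClosure {n : ℕ} (Ω : Set (E n)) (g : E n → ℝ) (Dg : E n → E n →L[ℝ] ℝ)
    (D2g : E n → E n →L[ℝ] E n →L[ℝ] ℝ) : Prop where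
  contDiffOn : ContDiffOn ℝ 2 g Ω
  continuousOn : ContinuousOn g (closure Ω)
  continuousOn_D : ContinuousOn Dg (closure Ω)
  continuousOn_D2 : ContinuousOn D2g (closure Ω)
  eqOn_D : EqOn Dg (fderiv ℝ g) Ω
  eqOn_D2 : EqOn D2g (fderiv ℝ (fderiv ℝ g)) Ω

/-! Pointwise geometry of a graph `{(x, g x)}` in Euclidean space of dimension `n + 1`, at a point
where `p` is the first derivative of `g` and `B` is the second derivative of `g`. The unit normal is
the upward one, `(-Dg, 1) / √(1 + |Dg|²)`. -/

/-- First fundamental form (induced metric) in the coordinates `x`: `δᵢⱼ + gᵢ gⱼ`. -/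
def firstForm {n : ℕ} (p : E n →L[ℝ] ℝ) : Matrix (Fin n) (Fin n) ℝ :=
  Matrix.of fun i j => (if i = j then 1 else 0) + p (e i) * p (e j)

/-- Second fundamental form in the coordinates `x`: `gᵢⱼ / √(1 + |Dg|²)`. -/
def secondForm {n : ℕ} (p : E n →L[ℝ] ℝ) (B : E n →L[ℝ] E n →L[ℝ] ℝ) :
    Matrix (Fin n) (Fin n) ℝ :=
  Matrix.of fun i j => B (e i) (e j) / √(1 + ‖p‖ ^ 2)

/-- Shape operator (Weingarten map): the second fundamental form with one index raised by the
induced metric. -/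
def shapeOperator {n : ℕ} (p : E n →L[ℝ] ℝ) (B : E n →L[ℝ] E n →L[ℝ] ℝ) :
    Matrix (Fin n) (Fin n) ℝ :=
  (firstForm p)⁻¹ * secondForm p B

/-- Principal curvatures `λ₁, …, λₙ`: the eigenvalues of the shape operator, with multiplicity. -/
def principalCurvatures {n : ℕ} (p : E n →L[ℝ] ℝ) (B : E n →L[ℝ] E n →L[ℝ] ℝ) : Multiset ℝ :=
  (shapeOperator p B).charpoly.roots

/-- Norm `|A|` of the second fundamental form with respect to the induced metric:
`|A|² = g^{ij} g^{kl} h_{ik} h_{jl}`. -/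
def normA {n : ℕ} (p : E n →L[ℝ] ℝ) (B : E n →L[ℝ] E n →L[ℝ] ℝ) : ℝ :=
  √(Matrix.trace (shapeOperator p B * shapeOperator p B))

/-- The cone `Γₖ`: `σ_l(λ) > 0` for `l = 1, …, k`. -/
def InGamma (k : ℕ) (l : Multiset ℝ) : Prop :=
  ∀ m : ℕ, 1 ≤ m → m ≤ k → 0 < l.esymm m

/-- `g` is a `k`-admissible solution in `Ω` of `σₖ(λ) = H(x, g) / (1 + |Dg|²)^(q/2)`, where `λ` are
the principal curvatures of the graph of `g`. -/
def IsAdmissibleSolution {n : ℕ} (k : ℕ) (q : ℝ) (Ω : Set (E n)) (H : E n × ℝ → ℝ)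
    (g : E n → ℝ) (Dg : E n → E n →L[ℝ] ℝ) (D2g : E n → E n →L[ℝ] E n →L[ℝ] ℝ) : Prop :=
  ∀ x ∈ Ω, InGamma k (principalCurvatures (Dg x) (D2g x)) ∧
    (principalCurvatures (Dg x) (D2g x)).esymm k
      = H (x, g x) / (1 + ‖Dg x‖ ^ 2) ^ (q / 2)

/-- On `S`, the function `H` is bounded below by `h₀`, and `H` and its derivatives of order one and
two are bounded by `K`. -/
def BoundsOn {n : ℕ} (h₀ K : ℝ) (H : E n × ℝ → ℝ) (S : Set (E n × ℝ)) : Prop :=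
  ∀ y ∈ S, h₀ ≤ H y ∧ ∀ j : ℕ, j ≤ 2 → ‖iteratedFDeriv ℝ j H y‖ ≤ K

end CurvatureGraph

end

/-! The proof is a maximum principle for an auxiliary function on the compact set `closure Ω`. With
`τ = 1/√(1+|Dg|²)`, the last component of the unit normal, the equation reads `σₖ(λ) = H τ^q`, and
the gradient bound keeps `τ` between `1/√(1+M²)` and `1`. If the maximum lies on the frontier, `|A|`
inside is controlled by its value there; if it is interior, `|A|` is bounded there outright.

For `k ≥ 2` the auxiliary function is `σ₁/τ`, because `|A| ≤ σ₁` on `Γ₂`. At an interior maximum the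
graph is written over its tangent plane in a principal frame, so that every quantity has an explicit
second order Taylor expansion along each axis. Fourth derivatives of the height commute; this is
Simons' identity (`sum_simons`). Contracted with `Fᵢ = ∂σₖ/∂λᵢ > 0`, exchanging the two index pairs
costs `σ₁ ∑ Fᵢλᵢ² - |A|² ∑ Fᵢλᵢ`, with `∑ Fᵢλᵢ = k σₖ` by Euler. Maximality bounds the second
derivatives of `σ₁` by those of `τ`, whose zero order part `-λⱼ²τ` cancels `σ₁ ∑ Fᵢλᵢ²`. The twice
differentiated equation would leave quadratic third order terms; concavity of `log σₖ - log σ₁`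
(`esH_le`) absorbs them, with a remainder `(1-q)(Dⱼτ/τ)²` whose sign is right as `q ≤ 1`. What
survives is `(k-q)|A|² ≤ O(1+|A|)` (`bound_of_two_le`).

For `k = 1` the equation already bounds `σ₁`, which says nothing about `|A|`. The auxiliary function
is then `|A|²/(τ-a)²` with `a` half the lower bound of `τ`. The shift `a` produces a term `|A|⁴
a/(τ-a)`, while all other terms are `O(|A|³)` for `|A| ≥ 1` (`bound_of_one`).

Off-diagonal entries of the shape operator are never differentiated. Schur's theorem in the form
`es_eigenvalues_le_es_diag` gives `σₖ(diagonal) ≥ σₖ(eigenvalues)` in any orthonormal frame, with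
equality at the base point where the frame is principal, so the equation becomes a one-sided
inequality for the diagonal entries that touches at the base point. That is enough for a first order
equality and a second order inequality. The algebra behind it is Newton's inequality and the
concavity of `σₖ₊₁/σₖ` on `Γₖ` (`Gam.add_and_esq_add_le`). -/

namespace CurvatureGraph

open Filter Topology

/-! ### Second order jets of functions of one real variable -/

/-- `f` is twice differentiable at `0`, and `a`, `b`, `c` are the values of `f`, `f'`, `f''` there. -/
def IsJet (f : ℝ → ℝ) (a b c : ℝ) : Prop :=
  f 0 = a ∧ ∃ f' : ℝ → ℝ, (∀ᶠ t in 𝓝 (0 : ℝ), HasDerivAt f (f' t) t) ∧ f' 0 = b ∧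
    HasDerivAt f' c 0

namespace IsJet

variable {f g : ℝ → ℝ} {a b c a' b' c' : ℝ}

theorem congr_val (hf : IsJet f a b c) (ha : a = a') (hb : b = b') (hc : c = c') :
    IsJet f a' b' c' := by
  subst ha hb hc; exact hf

theorem const (a : ℝ) : IsJet (fun _ => a) a 0 0 :=
  ⟨rfl, fun _ => 0, Eventually.of_forall fun t => hasDerivAt_const t a, rfl, hasDerivAt_const _ _⟩

theorem linear (a b : ℝ) : IsJet (fun t => a + t * b) a b 0 := by
  refine ⟨by simp, fun _ => b, Eventually.of_forall fun t => ?_, rfl, hasDerivAt_const _ _⟩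
  simpa using ((hasDerivAt_id t).mul_const b).const_add a

theorem congr (hf : IsJet f a b c) (h : g =ᶠ[𝓝 0] f) : IsJet g a b c := by
  obtain ⟨h0, f', h1, h2, h3⟩ := hf
  refine ⟨h.eq_of_nhds.trans h0, f', ?_, h2, h3⟩
  filter_upwards [h1, h.eventually_nhds] with t ht hg
  exact ht.congr_of_eventuallyEq hg

theorem continuousAt (hf : IsJet f a b c) : ContinuousAt f 0 := by
  obtain ⟨_, f', h1, _, _⟩ := hf
  exact h1.self_of_nhds.continuousAt

theorem add (hf : IsJet f a b c) (hg : IsJet g a' b' c') :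
    IsJet (fun t => f t + g t) (a + a') (b + b') (c + c') := by
  obtain ⟨h0, f', h1, h2, h3⟩ := hf
  obtain ⟨k0, g', k1, k2, k3⟩ := hg
  refine ⟨by simp [h0, k0], fun t => f' t + g' t, ?_, by simp [h2, k2], h3.add k3⟩
  filter_upwards [h1, k1] with t ht kt
  exact ht.add kt

theorem mul (hf : IsJet f a b c) (hg : IsJet g a' b' c') :
    IsJet (fun t => f t * g t) (a * a') (b * a' + a * b') (c * a' + 2 * (b * b') + a * c') := by
  obtain ⟨h0, f', h1, h2, h3⟩ := hf
  obtain ⟨k0, g', k1, k2, k3⟩ := hg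
  refine ⟨by simp [h0, k0], fun t => f' t * g t + f t * g' t, ?_, by simp [h0, h2, k0, k2], ?_⟩
  · filter_upwards [h1, k1] with t ht kt
    exact ht.mul kt
  · have := (h3.mul k1.self_of_nhds).add (h1.self_of_nhds.mul k3)
    refine this.congr_deriv ?_
    rw [h0, h2, k0, k2]; ring

theorem const_mul (r : ℝ) (hf : IsJet f a b c) :
    IsJet (fun t => r * f t) (r * a) (r * b) (r * c) :=
  ((const r).mul hf).congr_val rfl (by ring) (by ring)

theorem neg (hf : IsJet f a b c) : IsJet (fun t => -f t) (-a) (-b) (-c) := by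
  simpa using hf.const_mul (-1)

theorem sub (hf : IsJet f a b c) (hg : IsJet g a' b' c') :
    IsJet (fun t => f t - g t) (a - a') (b - b') (c - c') := by
  simpa [sub_eq_add_neg] using hf.add hg.neg

theorem sum {ι : Type*} (s : Finset ι) {f : ι → ℝ → ℝ} {a b c : ι → ℝ}
    (h : ∀ i ∈ s, IsJet (f i) (a i) (b i) (c i)) :
    IsJet (fun t => ∑ i ∈ s, f i t) (∑ i ∈ s, a i) (∑ i ∈ s, b i) (∑ i ∈ s, c i) := by
  classical
  induction s using Finset.induction_on with
  | empty => simpa using const 0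
  | insert i s hi ih =>
    simp only [Finset.sum_insert hi]
    exact (h i (Finset.mem_insert_self i s)).add
      (ih fun j hj => h j (Finset.mem_insert_of_mem hj))

theorem comp {F F' : ℝ → ℝ} {F'' : ℝ} (hF : ∀ᶠ s in 𝓝 a, HasDerivAt F (F' s) s)
    (hF' : HasDerivAt F' F'' a) (hf : IsJet f a b c) :
    IsJet (fun t => F (f t)) (F a) (F' a * b) (F'' * b ^ 2 + F' a * c) := by
  have hc := hf.continuousAt
  obtain ⟨h0, f', h1, h2, h3⟩ := hf
  refine ⟨by simp [h0], fun t => F' (f t) * f' t, ?_, by simp [h0, h2], ?_⟩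
  · have hc' : Tendsto f (𝓝 0) (𝓝 a) := by simpa [ContinuousAt, h0] using hc
    filter_upwards [h1, hc'.eventually hF] with t ht hFt
    exact hFt.comp t ht
  · have hF0 : HasDerivAt F' F'' (f 0) := by rwa [h0]
    refine ((hF0.comp 0 h1.self_of_nhds).mul h3).congr_deriv ?_
    simp only [Function.comp, h0, h2]; ring

theorem log (hf : IsJet f a b c) (ha : 0 < a) :
    IsJet (fun t => Real.log (f t)) (Real.log a) (b / a) (c / a - (b / a) ^ 2) := by
  refine (comp (F := Real.log) (F' := fun s => s⁻¹) ?_ (hasDerivAt_inv ha.ne') hf).congr_val rfl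
    (by field_simp) (by field_simp; ring)
  filter_upwards [eventually_ne_nhds ha.ne'] with s hs
  exact Real.hasDerivAt_log hs

theorem inv (hf : IsJet f a b c) (ha : a ≠ 0) :
    IsJet (fun t => (f t)⁻¹) a⁻¹ (-b / a ^ 2) (2 * b ^ 2 / a ^ 3 - c / a ^ 2) := by
  have h2 : HasDerivAt (fun s : ℝ => -(s ^ 2)⁻¹) (2 / a ^ 3) a := by
    refine (((hasDerivAt_pow 2 a).fun_inv (pow_ne_zero 2 ha)).fun_neg).congr_deriv ?_
    field_simp
    push_cast; ring
  refine (comp (F := fun s => s⁻¹) (F' := fun s => -(s ^ 2)⁻¹) ?_ h2 hf).congr_val rfl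
    (by field_simp) (by field_simp; ring)
  filter_upwards [eventually_ne_nhds ha] with s hs
  exact hasDerivAt_inv hs

theorem sqrt (hf : IsJet f a b c) (ha : 0 < a) :
    IsJet (fun t => √(f t)) (√a) (b / (2 * √a)) (c / (2 * √a) - b ^ 2 / (4 * a * √a)) := by
  have hs : 0 < √a := Real.sqrt_pos.2 ha
  have hsq : √a ^ 2 = a := Real.sq_sqrt ha.le
  have h2 : HasDerivAt (fun s : ℝ => 1 / (2 * √s)) (-1 / (4 * a * √a)) a := by
    have := (((Real.hasDerivAt_sqrt ha.ne').const_mul 2).fun_inv (by positivity))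
    simp only [one_div]
    refine this.congr_deriv ?_
    field_simp
    nlinarith
  refine (comp (F := Real.sqrt) (F' := fun s => 1 / (2 * √s)) ?_ h2 hf).congr_val rfl
    (by field_simp) (by field_simp; ring)
  filter_upwards [eventually_ne_nhds ha.ne'] with s hs
  exact Real.hasDerivAt_sqrt hs

theorem comp_neg (hf : IsJet f a b c) : IsJet (fun t => f (-t)) a (-b) c := by
  obtain ⟨h0, f', h1, h2, h3⟩ := hf
  have hn : Tendsto (fun t : ℝ => -t) (𝓝 0) (𝓝 0) := by simpa using (continuous_neg (G := ℝ)).tendsto 0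
  refine ⟨by simp [h0], fun t => -f' (-t), ?_, by simp [h2], ?_⟩
  · filter_upwards [hn.eventually h1] with t ht
    have := ht.comp t (hasDerivAt_neg t)
    simpa [Function.comp_def] using this
  · have h3' : HasDerivAt f' c (-0) := by simpa using h3
    have := (h3'.comp 0 (hasDerivAt_neg 0)).fun_neg
    simpa [Function.comp_def] using this

theorem unique (hf : IsJet f a b c) (hg : IsJet f a' b' c') : a = a' ∧ b = b' ∧ c = c' := by
  obtain ⟨h0, f', h1, h2, h3⟩ := hf
  obtain ⟨k0, g', k1, k2, k3⟩ := hg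
  have he : f' =ᶠ[𝓝 0] g' := by
    filter_upwards [h1, k1] with t ht kt using ht.unique kt
  exact ⟨h0 ▸ k0, by rw [← h2, ← k2, he.eq_of_nhds], h3.unique (k3.congr_of_eventuallyEq he)⟩

/-- A negative second derivative would make the point a local maximum as well, so the function would
be locally constant and its second derivative zero. -/
theorem of_isLocalMin (hf : IsJet f a b c) (h : IsLocalMin f 0) : b = 0 ∧ 0 ≤ c := by
  have hf' := hf
  obtain ⟨h0, f', h1, h2, h3⟩ := hf
  have hb : b = 0 := by rw [← h2]; exact h.hasDerivAt_eq_zero h1.self_of_nhds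
  refine ⟨hb, ?_⟩
  by_contra! hc
  have hd : deriv f =ᶠ[𝓝 0] f' := by
    filter_upwards [h1] with t ht using ht.deriv
  have hmax : IsLocalMax f 0 := by
    refine isLocalMax_of_deriv_deriv_neg ?_ ?_ hf'.continuousAt
    · rw [hd.deriv_eq, h3.deriv]; exact hc
    · rw [hd.eq_of_nhds, h2, hb]
  have hconst : f =ᶠ[𝓝 0] fun _ => a := by
    filter_upwards [h, hmax] with t ht kt
    rw [← h0]; exact le_antisymm kt ht
  have := (hf'.unique ((const a).congr hconst)).2.2
  linarith

theorem of_isLocalMax (hf : IsJet f a b c) (h : IsLocalMax f 0) : b = 0 ∧ c ≤ 0 := by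
  have := hf.neg.of_isLocalMin h.neg
  exact ⟨by linarith [this.1], by linarith [this.2]⟩

theorem of_eventually_ge (hf : IsJet f a b c) (h : ∀ᶠ t in 𝓝 0, a ≤ f t) : b = 0 ∧ 0 ≤ c :=
  hf.of_isLocalMin (by filter_upwards [h] with t ht; rwa [hf.1])

theorem of_eventually_le (hf : IsJet f a b c) (h : ∀ᶠ t in 𝓝 0, f t ≤ a) : b = 0 ∧ c ≤ 0 :=
  hf.of_isLocalMax (by filter_upwards [h] with t ht; rwa [hf.1])

end IsJet

end CurvatureGraph

noncomputable section

namespace CurvatureGraph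

open Finset Polynomial

variable {ι : Type*} [DecidableEq ι]

/-! ### Elementary symmetric functions of a finite family of real numbers -/

/-- The `k`-th elementary symmetric function of the family `x` restricted to `s`. -/
def es (s : Finset ι) (k : ℕ) (x : ι → ℝ) : ℝ := ∑ u ∈ s.powersetCard k, ∏ i ∈ u, x i

omit [DecidableEq ι] in
theorem es_zero (s : Finset ι) (x : ι → ℝ) : es s 0 x = 1 := by simp [es]

omit [DecidableEq ι] in
theorem es_one (s : Finset ι) (x : ι → ℝ) : es s 1 x = ∑ i ∈ s, x i := by
  simp [es, powersetCard_one]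

omit [DecidableEq ι] in
theorem es_smul (s : Finset ι) (k : ℕ) (r : ℝ) (x : ι → ℝ) : es s k (r • x) = r ^ k * es s k x := by
  simp only [es, Finset.mul_sum]
  refine sum_congr rfl fun u hu => ?_
  simp [Finset.prod_mul_distrib, (mem_powersetCard.1 hu).2]

theorem es_erase {s : Finset ι} {i : ι} (hi : i ∈ s) (k : ℕ) (x : ι → ℝ) :
    es s (k + 1) x = es (s.erase i) (k + 1) x + x i * es (s.erase i) k x := by
  have hni : i ∉ s.erase i := notMem_erase i s
  conv_lhs => rw [← insert_erase hi]
  rw [es, powersetCard_succ_insert hni, sum_union, sum_image]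
  · congr 1
    rw [es, Finset.mul_sum]
    refine sum_congr rfl fun u hu => ?_
    rw [Finset.prod_insert]
    exact fun h => hni ((mem_powersetCard.1 hu).1 h)
  · intro u hu v hv h
    have h1 : i ∉ u := fun h => hni ((mem_powersetCard.1 hu).1 h)
    have h2 : i ∉ v := fun h => hni ((mem_powersetCard.1 hv).1 h)
    rw [← erase_insert h1, ← erase_insert h2, h]
  · rw [Finset.disjoint_left]
    intro u hu hv
    obtain ⟨v, _, rfl⟩ := mem_image.1 hv
    exact hni ((mem_powersetCard.1 hu).1 (mem_insert_self i v))

/-- Double counting of pairs `i ∈ u`, recorded either as `(u, i)` or as `(i, u \ {i})`. Both Euler's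
identity and the derivative of `es` are instances. -/
theorem sum_powersetCard_succ (s : Finset ι) (k : ℕ) (f : ι → Finset ι → ℝ) :
    ∑ u ∈ s.powersetCard (k + 1), ∑ i ∈ u, f i (u.erase i)
      = ∑ i ∈ s, ∑ v ∈ (s.erase i).powersetCard k, f i v := by
  rw [sum_sigma', sum_sigma']
  refine sum_bij' (fun p _ => ⟨p.2, p.1.erase p.2⟩) (fun p _ => ⟨insert p.1 p.2, p.1⟩) ?_ ?_ ?_ ?_ ?_
  · rintro ⟨u, i⟩ h
    simp only [mem_sigma, mem_powersetCard] at h ⊢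
    obtain ⟨⟨h1, h2⟩, h3⟩ := h
    exact ⟨h1 h3, erase_subset_erase i h1, by rw [card_erase_of_mem h3, h2]; rfl⟩
  · rintro ⟨i, v⟩ h
    simp only [mem_sigma, mem_powersetCard] at h ⊢
    obtain ⟨h1, h2, h3⟩ := h
    have hv : i ∉ v := fun h => notMem_erase i s (h2 h)
    exact ⟨⟨insert_subset h1 (h2.trans (erase_subset i s)), by rw [card_insert_of_notMem hv, h3]⟩,
      mem_insert_self i v⟩
  · rintro ⟨u, i⟩ h
    simp only [mem_sigma] at h
    simp [insert_erase h.2]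
  · rintro ⟨i, v⟩ h
    simp only [mem_sigma, mem_powersetCard] at h
    have hv : i ∉ v := fun h' => notMem_erase i s (h.2.1 h')
    simp [erase_insert hv]
  · rintro ⟨u, i⟩ h
    rfl

theorem sum_mul_es_erase (s : Finset ι) (k : ℕ) (x : ι → ℝ) :
    ∑ i ∈ s, x i * es (s.erase i) k x = (k + 1) * es s (k + 1) x := by
  have := sum_powersetCard_succ s k fun i v => x i * ∏ j ∈ v, x j
  simp only [es, Finset.mul_sum] at this ⊢
  rw [← this]
  refine sum_congr rfl fun u hu => ?_
  rw [sum_congr rfl fun i hi => mul_prod_erase u x hi, sum_const, (mem_powersetCard.1 hu).2]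
  simp

/-! ### Newton's inequality -/

theorem splits_derivative {p : ℝ[X]} (hp : p.Splits) : (derivative p).Splits := by
  rw [splits_iff_card_roots] at hp ⊢
  refine le_antisymm (card_roots' _) ?_
  have h1 := card_roots_le_derivative p
  have h2 := natDegree_derivative_le p
  omega

theorem splits_iterate_derivative {p : ℝ[X]} (hp : p.Splits) (k : ℕ) :
    (derivative^[k] p).Splits := by
  induction k with
  | zero => exact hp
  | succ k ih => rw [Function.iterate_succ_apply']; exact splits_derivative ih

theorem two_mul_coeff_le_sq {p : ℝ[X]} (hp : p.Splits) :
    2 * (p.coeff 0 * p.coeff 2) ≤ p.coeff 1 ^ 2 := by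
  have key : ∀ r : Multiset ℝ, 2 * (((r.map fun a => X - C a).prod).coeff 0 *
      ((r.map fun a => X - C a).prod).coeff 2) ≤ ((r.map fun a => X - C a).prod).coeff 1 ^ 2 := by
    intro r
    -- Multiplying `q` by `X - a` turns `c₁² - 2c₀c₂` into `q₀² + a²(q₁² - 2q₀q₂)`, so nonnegativity
    -- propagates root by root.
    induction r using Multiset.induction_on with
    | empty => simp [coeff_one]
    | cons a r ih =>
      rw [Multiset.map_cons, Multiset.prod_cons]
      set q := (r.map fun a => X - C a).prod
      simp only [sub_mul, coeff_sub, coeff_C_mul, coeff_X_mul, coeff_X_mul_zero]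
      nlinarith [mul_le_mul_of_nonneg_left ih (sq_nonneg a), sq_nonneg (q.coeff 0)]
  rw [hp.eq_prod_roots]
  simp only [coeff_C_mul]
  nlinarith [mul_le_mul_of_nonneg_left (key p.roots) (sq_nonneg p.leadingCoeff)]

/-- The `m`-th derivative still splits, and its three lowest coefficients are those of `p` at `m`,
`m+1`, `m+2` with factorial weights. The previous lemma becomes `(m+2) cₘcₘ₊₂ ≤ (m+1) cₘ₊₁²`, which
is stronger than needed when the left side is positive. -/
theorem coeff_mul_coeff_le_sq {p : ℝ[X]} (hp : p.Splits) (m : ℕ) :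
    p.coeff m * p.coeff (m + 2) ≤ p.coeff (m + 1) ^ 2 := by
  have h := two_mul_coeff_le_sq (splits_iterate_derivative hp m)
  simp only [coeff_iterate_derivative, nsmul_eq_mul] at h
  have e0 : (0 + m).descFactorial m = m.factorial := by rw [zero_add, Nat.descFactorial_self]
  have e1 : (1 + m).descFactorial m = (m + 1) * m.factorial := by
    have := Nat.factorial_mul_descFactorial (n := 1 + m) (k := m) (by omega)
    rw [show 1 + m - m = 1 by omega, Nat.factorial_one, one_mul, add_comm 1 m,
      Nat.factorial_succ] at this
    rw [add_comm 1 m, this]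
  have e2 : 2 * (2 + m).descFactorial m = (m + 2) * ((m + 1) * m.factorial) := by
    have := Nat.factorial_mul_descFactorial (n := 2 + m) (k := m) (by omega)
    rw [show 2 + m - m = 2 by omega, Nat.factorial_two, add_comm 2 m,
      Nat.factorial_succ, Nat.factorial_succ] at this
    rw [add_comm 2 m, this]
  have e2' : 2 * ((2 + m).descFactorial m : ℝ) = (m + 2) * ((m + 1) * m.factorial) := by
    exact_mod_cast e2
  rw [e0, e1, zero_add, add_comm 1 m, add_comm 2 m] at h
  rw [add_comm 2 m] at e2'
  push_cast at h
  set f : ℝ := (m.factorial : ℝ)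
  have hf : 0 < f := by positivity
  have hm : (0 : ℝ) ≤ m := by positivity
  have h' : (f ^ 2 * (m + 1)) * ((m + 2) * (p.coeff m * p.coeff (m + 2)))
      ≤ (f ^ 2 * (m + 1)) * ((m + 1) * p.coeff (m + 1) ^ 2) := by
    calc _ = 2 * (f * p.coeff m * (((m + 2).descFactorial m : ℝ) * p.coeff (m + 2))) := by
          linear_combination (-f * p.coeff m * p.coeff (m + 2)) * e2'
      _ ≤ _ := h
      _ = _ := by ring
  have h3 := le_of_mul_le_mul_left h' (by positivity)
  rcases le_or_gt (p.coeff m * p.coeff (m + 2)) 0 with h0 | h0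
  · exact h0.trans (sq_nonneg _)
  · nlinarith

omit [DecidableEq ι] in
theorem es_mul_es_le_sq (s : Finset ι) (k : ℕ) (x : ι → ℝ) :
    es s k x * es s (k + 2) x ≤ es s (k + 1) x ^ 2 := by
  rcases lt_or_ge s.card (k + 2) with h | h
  · have : es s (k + 2) x = 0 := by simp [es, powersetCard_eq_empty.2 h]
    rw [this, mul_zero]; positivity
  · have hs : (∏ i ∈ s, (X + C (x i))).Splits := Splits.prod fun i _ => Splits.X_add_C (x i)
    have hc : ∀ j, j ≤ s.card → (∏ i ∈ s, (X + C (x i))).coeff (s.card - j) = es s j x := by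
      intro j hj
      rw [Finset.prod_X_add_C_coeff _ _ (Nat.sub_le _ _), es, Nat.sub_sub_self hj]
    have := coeff_mul_coeff_le_sq hs (s.card - (k + 2))
    rw [show s.card - (k + 2) + 2 = s.card - k by omega,
      show s.card - (k + 2) + 1 = s.card - (k + 1) by omega, hc _ h, hc _ (by omega),
      hc _ (by omega)] at this
    linarith

/-! ### The cones `Γₖ` and the concavity of quotients of elementary symmetric functions -/

/-- The cone `Γₖ` for the family `x` restricted to `s`. -/
def Gam (s : Finset ι) (k : ℕ) (x : ι → ℝ) : Prop := ∀ l ≤ k, 0 < es s l x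

omit [DecidableEq ι] in
theorem Gam.mono {s : Finset ι} {k l : ℕ} {x : ι → ℝ} (h : Gam s k x) (hl : l ≤ k) : Gam s l x :=
  fun m hm => h m (hm.trans hl)

omit [DecidableEq ι] in
theorem Gam.smul {s : Finset ι} {k : ℕ} {x : ι → ℝ} (h : Gam s k x) {r : ℝ} (hr : 0 < r) :
    Gam s k (r • x) := fun l hl => by
  rw [es_smul]; exact mul_pos (pow_pos hr l) (h l hl)

/-- This makes `∂σₖ₊₁/∂xᵢ` positive on `Γₖ₊₁`. With `A`, `b`, `d` the functions of degree `k`,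
`k+1`, `k+2` without `xᵢ`, suppose `b ≤ 0`. Newton's `Ad ≤ b²` and `d + xᵢb > 0` give `b(b + xᵢA) >
0`, against `b + xᵢA > 0`. -/
theorem Gam.erase {s : Finset ι} {k : ℕ} {x : ι → ℝ} {i : ι} (hi : i ∈ s)
    (h : Gam s (k + 1) x) : Gam (s.erase i) k x := by
  induction k with
  | zero =>
    intro l hl
    obtain rfl : l = 0 := by omega
    rw [es_zero]; exact one_pos
  | succ k ih =>
    have ih := ih (h.mono (by omega))
    intro l hl
    rcases Nat.lt_or_ge l (k + 1) with hl' | hl'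
    · exact ih l (by omega)
    · obtain rfl : l = k + 1 := by omega
      have hA := ih k le_rfl
      have h1 := h (k + 1) (by omega)
      have h2 := h (k + 1 + 1) le_rfl
      rw [es_erase hi] at h1 h2
      have hN := es_mul_es_le_sq (s.erase i) k x
      by_contra! hb
      set A := es (s.erase i) k x
      set b := es (s.erase i) (k + 1) x
      set d := es (s.erase i) (k + 2) x
      have e1 : A * d + A * (x i * b) > 0 := by nlinarith
      nlinarith [mul_nonneg (neg_nonneg.2 hb) h1.le]

/-- The quotient of consecutive elementary symmetric functions. -/
def esq (s : Finset ι) (k : ℕ) (x : ι → ℝ) : ℝ := es s (k + 1) x / es s k x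

omit [DecidableEq ι] in
theorem esq_smul (s : Finset ι) (k : ℕ) {r : ℝ} (hr : r ≠ 0) (x : ι → ℝ) :
    esq s k (r • x) = r * esq s k x := by
  rw [esq, esq, es_smul, es_smul, pow_succ, mul_assoc, mul_div_mul_left _ _ (pow_ne_zero k hr),
    mul_div_assoc]

theorem add_esq_erase {s : Finset ι} {k : ℕ} {x : ι → ℝ} {i : ι} (hi : i ∈ s)
    (h : Gam s (k + 1) x) :
    x i + esq (s.erase i) k x = es s (k + 1) x / es (s.erase i) k x := by
  have := (h.erase hi k le_rfl).ne'
  rw [esq, es_erase hi]; field_simp; ring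

/-- Euler's identity combined with `xᵢσₖ₊₁(s\i) = xᵢσₖ₊₁ - xᵢ²σₖ(s\i)`. It expresses each quotient
through the quotient one degree lower as linear terms minus terms `x²/y`, the form on which the
concavity induction runs. -/
theorem add_two_mul_esq {s : Finset ι} {k : ℕ} {x : ι → ℝ} (h : Gam s (k + 1) x) :
    (k + 2) * esq s (k + 1) x = ∑ i ∈ s, (x i - x i ^ 2 / (x i + esq (s.erase i) k x)) := by
  have h1 := (h (k + 1) le_rfl).ne'
  have h2 := sum_mul_es_erase s (k + 1) x
  push_cast at h2
  rw [esq, mul_div_assoc', eq_comm, eq_div_iff h1, Finset.sum_mul,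
    show ((k : ℝ) + 2) = k + 1 + 1 by ring, ← h2]
  refine sum_congr rfl fun i hi => ?_
  have h3 := (h.erase hi k le_rfl).ne'
  rw [add_esq_erase hi h, div_div_eq_mul_div, sub_mul, div_mul_cancel₀ _ h1, es_erase hi]
  ring

theorem sq_div_add_le {x z y w : ℝ} (hy : 0 < y) (hw : 0 < w) :
    (x + z) ^ 2 / (y + w) ≤ x ^ 2 / y + z ^ 2 / w := by
  rw [div_add_div _ _ hy.ne' hw.ne', div_le_div_iff₀ (by positivity) (by positivity)]
  nlinarith [sq_nonneg (x * w - z * y)]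

/-- For functions homogeneous of degree one, superadditivity is concavity. In the induction, `x²/y`
is jointly subadditive and decreasing in `y`, and the denominators are superadditive by the case of
lower degree. The cone is closed under addition because positivity of the next `σ` is positivity of
the quotient. -/
theorem Gam.add_and_esq_add_le (k : ℕ) : ∀ {s : Finset ι} {x z : ι → ℝ}, Gam s k x → Gam s k z →
    Gam s k (x + z) ∧ esq s k x + esq s k z ≤ esq s k (x + z) := by
  induction k with
  | zero =>
    intro s x z _ _
    refine ⟨fun l hl => ?_, ?_⟩
    · obtain rfl : l = 0 := by omega
      rw [es_zero]; exact one_pos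
    · simp [esq, es_one, es_zero, sum_add_distrib]
  | succ k ih =>
    intro s x z hx hz
    obtain ⟨h1, h2⟩ := ih (hx.mono k.le_succ) (hz.mono k.le_succ)
    have hxz : Gam s (k + 1) (x + z) := by
      intro l hl
      rcases Nat.lt_or_ge l (k + 1) with hl' | hl'
      · exact h1 l (by omega)
      · obtain rfl : l = k + 1 := by omega
        have e1 : 0 < esq s k x := div_pos (hx _ le_rfl) (hx _ (by omega))
        have e2 : 0 < esq s k z := div_pos (hz _ le_rfl) (hz _ (by omega))
        have e3 : 0 < esq s k (x + z) := by linarith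
        have := mul_pos e3 (h1 k le_rfl)
        rwa [esq, div_mul_cancel₀ _ (h1 k le_rfl).ne'] at this
    refine ⟨hxz, ?_⟩
    have hpos : (0 : ℝ) < k + 2 := by positivity
    refine le_of_mul_le_mul_left ?_ hpos
    rw [mul_add, add_two_mul_esq hx, add_two_mul_esq hz, add_two_mul_esq hxz, ← sum_add_distrib]
    refine sum_le_sum fun i hi => ?_
    have q1 := (ih (hx.erase hi) (hz.erase hi)).2
    have y1 : 0 < x i + esq (s.erase i) k x := by
      rw [add_esq_erase hi hx]; exact div_pos (hx _ le_rfl) (hx.erase hi k le_rfl)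
    have y2 : 0 < z i + esq (s.erase i) k z := by
      rw [add_esq_erase hi hz]; exact div_pos (hz _ le_rfl) (hz.erase hi k le_rfl)
    have y3 := sq_div_add_le (x := x i) (z := z i) y1 y2
    have y4 : (x i + z i) ^ 2 / ((x + z) i + esq (s.erase i) k (x + z))
        ≤ (x i + z i) ^ 2 / (x i + esq (s.erase i) k x + (z i + esq (s.erase i) k z)) := by
      refine div_le_div_of_nonneg_left (sq_nonneg _) (by positivity) ?_
      simp only [Pi.add_apply]; linarith
    simp only [Pi.add_apply] at y4 ⊢
    linarith

/-- Midpoint log-concavity of `σₖ/σ₁` with denominators cleared: `σₖ/σ₁` is the product of the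
concave positive quotients `esq s l` for `1 ≤ l < k`. -/
theorem es_mul_es_mul_sq_le {s : Finset ι} {k : ℕ} {x y z : ι → ℝ} (hx : Gam s k x)
    (hz : Gam s k z) (hxz : x + z = (2 : ℝ) • y) (hk : 1 ≤ k) :
    es s k x * es s k z * es s 1 y ^ 2 ≤ es s k y ^ 2 * (es s 1 x * es s 1 z) := by
  induction k, hk using Nat.le_induction with
  | base => exact le_of_eq (by ring)
  | succ k hk ih =>
    have ih := ih (hx.mono k.le_succ) (hz.mono k.le_succ)
    have hy : Gam s (k + 1) y := by
      have := ((Gam.add_and_esq_add_le (k + 1) hx hz).1).smul (r := 1 / 2) (by norm_num)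
      rw [hxz, smul_smul] at this
      simpa using this
    have hq := (Gam.add_and_esq_add_le k (hx.mono k.le_succ) (hz.mono k.le_succ)).2
    rw [hxz, esq_smul _ _ two_ne_zero] at hq
    have px := hx k k.le_succ
    have pz := hz k k.le_succ
    have py := hy k k.le_succ
    have qx : 0 < esq s k x := div_pos (hx _ le_rfl) px
    have qz : 0 < esq s k z := div_pos (hz _ le_rfl) pz
    have ex : es s (k + 1) x = esq s k x * es s k x := by rw [esq, div_mul_cancel₀ _ px.ne']
    have ez : es s (k + 1) z = esq s k z * es s k z := by rw [esq, div_mul_cancel₀ _ pz.ne']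
    have ey : es s (k + 1) y = esq s k y * es s k y := by rw [esq, div_mul_cancel₀ _ py.ne']
    have hqq : esq s k x * esq s k z ≤ esq s k y ^ 2 := by
      nlinarith [sq_nonneg (esq s k x - esq s k z)]
    have h1x := hx 1 (by omega)
    have h1z := hz 1 (by omega)
    rw [ex, ez, ey]
    calc _ = (esq s k x * esq s k z) * (es s k x * es s k z * es s 1 y ^ 2) := by ring
      _ ≤ esq s k y ^ 2 * (es s k y ^ 2 * (es s 1 x * es s 1 z)) := by
        refine mul_le_mul hqq ih (by positivity) (by positivity)
      _ = _ := by ring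

/-! ### Diagonal entries and eigenvalues -/

omit [DecidableEq ι] in
theorem es_comp_perm [Fintype ι] (k : ℕ) (x : ι → ℝ) (π : Equiv.Perm ι) :
    es univ k (x ∘ π) = es univ k x := by
  have h : ∀ y : ι → ℝ, es univ k y = (univ.val.map y).esymm k := fun y =>
    (Finset.esymm_map_val y univ k).symm
  rw [h, h, ← Multiset.map_map]
  congr 2
  simp

/-- By Birkhoff, `P x` is a convex combination of permutations of `x`. The part of `Γₖ` where every
quotient `esq` is at least its value at `x` is convex and contains these permutations; multiplying
the quotients recovers `σₖ`. -/
theorem es_le_es_of_doublyStochastic [Fintype ι] {k : ℕ} {x : ι → ℝ} (hx : Gam univ k x)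
    {P : Matrix ι ι ℝ} (hP : P ∈ doublyStochastic ℝ ι) :
    Gam univ k (P.mulVec x) ∧ es univ k x ≤ es univ k (P.mulVec x) := by
  let S : Set (ι → ℝ) := {y | Gam univ k y ∧ ∀ l < k, esq univ l x ≤ esq univ l y}
  have hS : Convex ℝ S := by
    rw [convex_iff_forall_pos]
    rintro y ⟨hy, hy'⟩ z ⟨hz, hz'⟩ a b ha hb hab
    refine ⟨(Gam.add_and_esq_add_le k (hy.smul ha) (hz.smul hb)).1, fun l hl => ?_⟩
    have h1 := (Gam.add_and_esq_add_le l ((hy.smul ha).mono hl.le) ((hz.smul hb).mono hl.le)).2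
    rw [esq_smul _ _ ha.ne', esq_smul _ _ hb.ne'] at h1
    have h2 := mul_le_mul_of_nonneg_left (hy' l hl) ha.le
    have h3 := mul_le_mul_of_nonneg_left (hz' l hl) hb.le
    calc esq univ l x = a * esq univ l x + b * esq univ l x := by rw [← add_mul, hab, one_mul]
      _ ≤ _ := by linarith
  have hmem : P.mulVec x ∈ S := by
    rw [← SetLike.mem_coe, doublyStochastic_eq_convexHull_permMatrix] at hP
    have hconv : Convex ℝ {Q : Matrix ι ι ℝ | Q.mulVec x ∈ S} := by
      intro Q hQ R hR a b ha hb hab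
      have := hS hQ hR ha hb hab
      simpa [Matrix.add_mulVec, Matrix.smul_mulVec] using this
    refine convexHull_min ?_ hconv hP
    rintro Q ⟨π, rfl⟩
    have he : ∀ l, es univ l (x ∘ π) = es univ l x := fun l => es_comp_perm l x π
    simp only [Set.mem_ofPred_eq, Matrix.permMatrix_mulVec, S]
    exact ⟨fun l hl => by rw [he]; exact hx l hl, fun l _ => by simp only [esq, he]; exact le_rfl⟩
  obtain ⟨h1, h2⟩ := hmem
  refine ⟨h1, ?_⟩
  have : ∀ l ≤ k, es univ l x ≤ es univ l (P.mulVec x) := by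
    intro l
    induction l with
    | zero => intro _; simp [es_zero]
    | succ l ih =>
      intro hl
      have ih := ih (by omega)
      have q := h2 l (by omega)
      have px := hx l (by omega)
      have pz := h1 l (by omega)
      have ex : es univ (l + 1) x = esq univ l x * es univ l x := by
        rw [esq, div_mul_cancel₀ _ px.ne']
      have ez : es univ (l + 1) (P.mulVec x) = esq univ l (P.mulVec x) * es univ l (P.mulVec x) := by
        rw [esq, div_mul_cancel₀ _ pz.ne']
      rw [ex, ez]
      have qx : 0 < esq univ l x := div_pos (hx _ hl) px
      exact mul_le_mul q ih px.le (qx.le.trans q)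
  exact this k le_rfl

/-- Schur: the diagonal is the image of the eigenvalues under the doubly stochastic matrix `Uᵢⱼ²`,
with `U` an orthogonal matrix of eigenvectors. -/
theorem es_eigenvalues_le_es_diag [Fintype ι] {A : Matrix ι ι ℝ} (hA : A.IsHermitian) {k : ℕ}
    (h : Gam univ k hA.eigenvalues) :
    Gam univ k A.diag ∧ es univ k hA.eigenvalues ≤ es univ k A.diag := by
  have hU := hA.eigenvectorUnitary.2
  set U : Matrix ι ι ℝ := (hA.eigenvectorUnitary : Matrix ι ι ℝ) with hUdef
  have h1 : U * star U = 1 := Unitary.mul_star_self_of_mem hU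
  have h2 : star U * U = 1 := Unitary.star_mul_self_of_mem hU
  let P : Matrix ι ι ℝ := Matrix.of fun i j => U i j ^ 2
  have hP : P ∈ doublyStochastic ℝ ι := by
    rw [mem_doublyStochastic_iff_sum]
    refine ⟨fun i j => sq_nonneg _, fun i => ?_, fun j => ?_⟩
    · have := congrFun (congrFun h1 i) i
      simpa [Matrix.mul_apply, P, sq, Matrix.star_apply] using this
    · have := congrFun (congrFun h2 j) j
      simpa [Matrix.mul_apply, P, sq, Matrix.star_apply] using this
  have hd : A.diag = P.mulVec hA.eigenvalues := by
    ext i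
    have := congrFun (congrFun hA.spectral_theorem i) i
    rw [Matrix.diag_apply, this, Unitary.conjStarAlgAut_apply, ← hUdef, Matrix.mul_apply]
    simp only [Matrix.mulVec, dotProduct, P, Matrix.of_apply, Matrix.mul_diagonal,
      Matrix.star_apply, star_trivial]
    refine sum_congr rfl fun j _ => ?_
    simp only [Function.comp_apply, RCLike.ofReal_real_eq_id, id]
    ring
  rw [hd]
  exact es_le_es_of_doublyStochastic h hP

end CurvatureGraph

end

noncomputable section

namespace CurvatureGraph

open Finset Filter Topology

variable {ι : Type*} [DecidableEq ι]

/-! ### Derivatives of elementary symmetric functions -/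

/-- The derivative of `es s k` at `a` in the direction `b`. -/
def esD (s : Finset ι) : ℕ → (ι → ℝ) → (ι → ℝ) → ℝ
  | 0, _, _ => 0
  | k + 1, a, b => ∑ i ∈ s, b i * es (s.erase i) k a

/-- The second derivative of `es s k` at `a` in the direction `b`. -/
def esH (s : Finset ι) : ℕ → (ι → ℝ) → (ι → ℝ) → ℝ
  | 0, _, _ => 0
  | k + 1, a, b => ∑ i ∈ s, b i * esD (s.erase i) k a b

theorem hasDerivAt_es (s : Finset ι) (k : ℕ) {x : ι → ℝ → ℝ} {x' : ι → ℝ} {t : ℝ}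
    (h : ∀ i ∈ s, HasDerivAt (x i) (x' i) t) :
    HasDerivAt (fun t => es s k fun i => x i t) (esD s k (fun i => x i t) x') t := by
  cases k with
  | zero => simpa [es, esD] using hasDerivAt_const t (1 : ℝ)
  | succ k =>
    have h1 : HasDerivAt (fun t => ∑ u ∈ s.powersetCard (k + 1), ∏ i ∈ u, x i t)
        (∑ u ∈ s.powersetCard (k + 1), ∑ i ∈ u, (∏ j ∈ u.erase i, x j t) • x' i) t :=
      HasDerivAt.fun_sum fun u hu => HasDerivAt.fun_finsetProd fun i hi =>
        h i ((mem_powersetCard.1 hu).1 hi)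
    refine h1.congr_deriv ?_
    have := sum_powersetCard_succ s k fun i v => (∏ j ∈ v, x j t) • x' i
    rw [this]
    simp only [esD, es, Finset.mul_sum, smul_eq_mul, mul_comm]

theorem isJet_es (s : Finset ι) (k : ℕ) {x : ι → ℝ → ℝ} {a b c : ι → ℝ}
    (h : ∀ i, IsJet (x i) (a i) (b i) (c i)) :
    IsJet (fun t => es s k fun i => x i t) (es s k a) (esD s k a b)
      (esD s k a c + esH s k a b) := by
  choose h0 x' h1 h2 h3 using h
  have ea : (fun i => x i 0) = a := funext h0
  have eb : (fun i => x' i 0) = b := funext h2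
  have hev : ∀ᶠ t in 𝓝 (0 : ℝ), ∀ i ∈ s, HasDerivAt (x i) (x' i t) t :=
    (eventually_all_finset s).2 fun i _ => h1 i
  refine ⟨by simp only [ea], fun t => esD s k (fun i => x i t) fun i => x' i t, ?_, by simp only [ea, eb], ?_⟩
  · filter_upwards [hev] with t ht
    exact hasDerivAt_es s k ht
  · cases k with
    | zero => simpa [esD, esH] using hasDerivAt_const (0 : ℝ) (0 : ℝ)
    | succ k =>
      have : ∀ i ∈ s, HasDerivAt (fun t => x' i t * es (s.erase i) k fun j => x j t)
          (c i * es (s.erase i) k a + b i * esD (s.erase i) k a b) 0 := by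
        intro i hi
        have h4 := hasDerivAt_es (s.erase i) k (x := x) (x' := b) (t := 0) fun j hj => by
          rw [← h2 j]; exact (h1 j).self_of_nhds
        have := (h3 i).fun_mul h4
        simpa only [ea, h2] using this
      have h5 := HasDerivAt.fun_sum this
      simp only [esD, esH]
      rw [← sum_add_distrib]
      exact h5

theorem esD_zero_right (s : Finset ι) (k : ℕ) (a : ι → ℝ) : esD s k a (fun _ => 0) = 0 := by
  cases k <;> simp [esD]

theorem esD_one (s : Finset ι) (a b : ι → ℝ) : esD s 1 a b = ∑ i ∈ s, b i := by
  simp [esD, es_zero]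

theorem esH_one (s : Finset ι) (a b : ι → ℝ) : esH s 1 a b = 0 := by simp [esH, esD]

/-- Concavity of `log σₖ - log σ₁` on `Γₖ`. -/
theorem esH_le {s : Finset ι} {k : ℕ} (hk : 1 ≤ k) {a : ι → ℝ} (ha : Gam s k a) (b : ι → ℝ) :
    esH s k a b / es s k a - (esD s k a b / es s k a) ^ 2 + ((∑ i ∈ s, b i) / ∑ i ∈ s, a i) ^ 2
      ≤ 0 := by
  have jl : ∀ l, IsJet (fun t => es s l fun i => a i + t * b i) (es s l a) (esD s l a b)
      (esH s l a b) := fun l =>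
    (isJet_es s l fun i => IsJet.linear (a i) (b i)).congr_val rfl rfl (by rw [esD_zero_right, zero_add])
  have jn : ∀ l, IsJet (fun t => es s l fun i => a i + -t * b i) (es s l a) (-esD s l a b)
      (esH s l a b) := fun l => (jl l).comp_neg
  have hG : ∀ᶠ t in 𝓝 (0 : ℝ), Gam s k fun i => a i + t * b i := by
    have : ∀ᶠ t in 𝓝 (0 : ℝ), ∀ l ∈ range (k + 1), 0 < es s l fun i => a i + t * b i := by
      refine (eventually_all_finset _).2 fun l hl => ?_
      refine (jl l).continuousAt.eventually (lt_mem_nhds ?_)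
      simpa using ha l (by simpa [Nat.lt_succ_iff] using hl)
    filter_upwards [this] with t ht l hl
    exact ht l (by simpa [Nat.lt_succ_iff] using hl)
  have hn : Tendsto (fun t : ℝ => -t) (𝓝 0) (𝓝 0) := by
    simpa using (continuous_neg (G := ℝ)).tendsto 0
  have h1 := ha 1 hk
  have h2 := ha k le_rfl
  -- The midpoint inequality at `a ± tb` says that this function, which vanishes at `t = 0`, is
  -- nonnegative nearby. Since `(f(t) f(-t))'' = 2(f f'' - f'²)` at `0`, its second derivative there
  -- is the claim up to a positive factor.
  have J := (((jl 1).mul (jn 1)).const_mul (es s k a ^ 2)).sub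
    (((jl k).mul (jn k)).const_mul (es s 1 a ^ 2))
  have hmin : IsLocalMin (fun t => es s k a ^ 2 * ((es s 1 fun i => a i + t * b i) *
      es s 1 fun i => a i + -t * b i) - es s 1 a ^ 2 * ((es s k fun i => a i + t * b i) *
      es s k fun i => a i + -t * b i)) 0 := by
    filter_upwards [hG, hn.eventually hG] with t ht ht'
    have := es_mul_es_mul_sq_le (y := a) ht ht' (by ext i; simp; ring) hk
    simp only [neg_zero, zero_mul, add_zero]
    nlinarith
  have := (J.of_isLocalMin hmin).2
  rw [esH_one, esD_one] at this
  rw [← es_one s a, div_pow, div_pow, div_sub_div _ _ h2.ne' (by positivity),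
    div_add_div _ _ (by positivity) (by positivity)]
  refine div_nonpos_of_nonpos_of_nonneg ?_ (by positivity)
  nlinarith

end CurvatureGraph

end

noncomputable section

namespace CurvatureGraph

open Finset Filter Topology

/-! ### The pointwise inequalities at an interior maximum

In the direction `l`, the functions `d l i`, `tau l`, `hh l` are the diagonal entries of the shape
operator in an orthonormal frame, the last component of the unit normal, and the values of `H`. -/

/-- The jets along the coordinate directions of a graph over its tangent plane. -/
structure GraphJets {n : ℕ} (l T₁ e₁ : Fin n → ℝ) (T N : Fin n → Fin n → ℝ) (τ h θ : ℝ)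
    (ζ : Fin n → ℝ) (d : Fin n → Fin n → ℝ → ℝ) (tau hh : Fin n → ℝ → ℝ) : Prop where
  symm : ∀ i j, N i j = N j i
  tau_pos : 0 < τ
  h_pos : 0 < h
  d_jet : ∀ j i, IsJet (d j i) (l i) (T i j)
    (N i j - l i * l j ^ 2 - 2 * (if i = j then l j ^ 3 else 0))
  tau_jet : ∀ j, IsJet (tau j) τ (-(l j * e₁ j)) (-(l j ^ 2 * τ) - ∑ m, T j m * e₁ m)
  h_jet : ∀ j, IsJet (hh j) h (T₁ j) (ζ j + l j * θ)

namespace GraphJets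

variable {n : ℕ} {l η ε : Fin n → ℝ} {T N : Fin n → Fin n → ℝ} {τ h θ : ℝ}
    {ζ : Fin n → ℝ} {d : Fin n → Fin n → ℝ → ℝ} {tau hh : Fin n → ℝ → ℝ}

/-- Simons' identity, contracted with a vector `F`. -/
theorem sum_simons (G : GraphJets l η ε T N τ h θ ζ d tau hh) (F : Fin n → ℝ) :
    ∑ j, ∑ i, (N i j - l i * l j ^ 2 - 2 * (if i = j then l j ^ 3 else 0)) * F i
      = (∑ i, F i * ∑ j, (N j i - l j * l i ^ 2 - 2 * (if j = i then l i ^ 3 else 0)))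
        + (∑ j, l j) * (∑ i, F i * l i ^ 2) - (∑ j, l j ^ 2) * ∑ i, F i * l i := by
  rw [sum_comm, Finset.sum_mul_sum, Finset.sum_mul_sum]
  rw [sum_comm (f := fun i j => l i * (F j * l j ^ 2)), sum_comm (f := fun i j => l i ^ 2 * (F j * l j)),
    ← sum_add_distrib, ← sum_sub_distrib]
  refine sum_congr rfl fun i _ => ?_
  rw [Finset.mul_sum, ← sum_add_distrib, ← sum_sub_distrib]
  refine sum_congr rfl fun j _ => ?_
  -- Symmetry of the fourth derivatives is the only geometric input; the rest is the difference of
  -- the explicit cubic terms.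
  rw [G.symm i j]
  by_cases hij : i = j
  · subst hij; simp; ring
  · simp [hij, Ne.symm hij]; ring

theorem eventually_pos {f : ℝ → ℝ} {a b c : ℝ} (hf : IsJet f a b c) (ha : 0 < a) :
    ∀ᶠ t in 𝓝 0, 0 < f t :=
  hf.continuousAt.eventually (lt_mem_nhds (by rw [hf.1]; exact ha))

/-- Compares two touching conditions along each axis: the equation, as an inequality for `log σₖ`,
and maximality of `log σ₁ - log τ`. Here `ε` holds the last components of the tangent frame, `T` and
`N` the third and fourth derivatives of the height, and `η`, `ζ`, `θ` the derivatives of `H` along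
the frame, twice along it, and along the normal. -/
theorem bound_of_two_le (G : GraphJets l η ε T N τ h θ ζ d tau hh) {k : ℕ} {q : ℝ}
    (hk : 1 ≤ k) (hq : q ≤ 1) (hG : Gam univ k l) (heq : es univ k l = h * τ ^ q)
    (hle : ∀ j, ∀ᶠ t in 𝓝 0, hh j t * tau j t ^ q ≤ es univ k fun i => d j i t)
    (hmax : ∀ j, ∀ᶠ t in 𝓝 0, (∑ i, d j i t) / tau j t ≤ (∑ i, l i) / τ) :
    (k - q) * ∑ i, l i ^ 2 ≤ -(((∑ i, l i) / τ) * ∑ m, ε m * η m / h)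
      - ∑ j, ((ζ j + l j * θ) / h - (η j / h) ^ 2) := by
  obtain ⟨k, rfl⟩ : ∃ k', k = k' + 1 := ⟨k - 1, by omega⟩
  set σ := es univ (k + 1) l with hσ
  set s1 := ∑ i, l i with hs1
  set F : Fin n → ℝ := fun i => es (univ.erase i) k l with hF
  have hτ := G.tau_pos
  have hh0 := G.h_pos
  have hσ0 : 0 < σ := hG _ le_rfl
  have hs0 : 0 < s1 := by have := hG 1 (by omega); rwa [es_one] at this
  have hF0 : ∀ i, 0 < F i := fun i => hG.erase (mem_univ i) k le_rfl
  set W : Fin n → Fin n → ℝ := fun i j => N i j - l i * l j ^ 2 - 2 * (if i = j then l j ^ 3 else 0)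
    with hW
  set t2 : Fin n → ℝ := fun j => -(l j ^ 2 * τ) - ∑ m, T j m * ε m with ht2
  set b : Fin n → ℝ := fun j => -(l j * ε j) / τ with hb
  set hterm : Fin n → ℝ := fun j => (ζ j + l j * θ) / h - (η j / h) ^ 2 with hterm_def
  have jes : ∀ j, IsJet (fun t => es univ (k + 1) fun i => d j i t) σ (∑ i, T i j * F i)
      ((∑ i, W i j * F i) + esH univ (k + 1) l fun i => T i j) := fun j =>
    isJet_es univ (k + 1) (G.d_jet j)
  have jsum : ∀ j, IsJet (fun t => ∑ i, d j i t) s1 (∑ i, T i j) (∑ i, W i j) := fun j =>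
    IsJet.sum univ fun i _ => G.d_jet j i
  -- The function `log σₖ(d) - log H - q log τ` is nonnegative near `0` and vanishes at `0`.
  have A : ∀ j, (∑ i, T i j * F i) / σ = η j / h + q * b j ∧
      hterm j + q * (t2 j / τ - b j ^ 2) ≤
        ((∑ i, W i j * F i) + esH univ (k + 1) l fun i => T i j) / σ
          - ((∑ i, T i j * F i) / σ) ^ 2 := by
    intro j
    have J := ((jes j).log hσ0).sub (((G.h_jet j).log hh0).add
      (((G.tau_jet j).log hτ).const_mul q))
    have z : Real.log σ - (Real.log h + q * Real.log τ) = 0 := by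
      rw [heq, Real.log_mul hh0.ne' (Real.rpow_pos_of_pos hτ q).ne', Real.log_rpow hτ, sub_self]
    have hmin : ∀ᶠ t in 𝓝 0, Real.log σ - (Real.log h + q * Real.log τ) ≤
        Real.log (es univ (k + 1) fun i => d j i t) -
          (Real.log (hh j t) + q * Real.log (tau j t)) := by
      filter_upwards [hle j, eventually_pos (G.tau_jet j) hτ, eventually_pos (G.h_jet j) hh0]
        with t h1 h2 h3
      rw [z, ← Real.log_rpow h2, ← Real.log_mul h3.ne' (Real.rpow_pos_of_pos h2 q).ne']
      exact sub_nonneg.2 (Real.log_le_log (mul_pos h3 (Real.rpow_pos_of_pos h2 q)) h1)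
    obtain ⟨J1, J2⟩ := J.of_eventually_ge hmin
    exact ⟨by linarith, by linarith⟩
  have B : ∀ j, (∑ i, T i j) / s1 = b j ∧ (∑ i, W i j) ≤ s1 * t2 j / τ := by
    intro j
    have J := ((jsum j).log hs0).sub ((G.tau_jet j).log hτ)
    have hM : ∀ᶠ t in 𝓝 0, Real.log (∑ i, d j i t) - Real.log (tau j t)
        ≤ Real.log s1 - Real.log τ := by
      filter_upwards [hmax j, eventually_pos (G.tau_jet j) hτ, eventually_pos (jsum j) hs0]
        with t h1 h2 h3
      rw [← Real.log_div h3.ne' h2.ne', ← Real.log_div hs0.ne' hτ.ne']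
      exact Real.log_le_log (div_pos h3 h2) h1
    obtain ⟨J1, J2⟩ := J.of_eventually_le hM
    have J1' : (∑ i, T i j) / s1 = b j := by linarith
    refine ⟨J1', ?_⟩
    rw [J1'] at J2
    have : (∑ i, W i j) / s1 ≤ t2 j / τ := by linarith
    rw [div_le_iff₀ hs0] at this
    calc _ ≤ _ := this
      _ = _ := by ring
  -- Concavity leaves `-b²` on the right, where `b = Dⱼτ/τ = Dⱼσ₁/σ₁` by criticality, against `-q
  -- b²` on the left. The surplus `(1-q) b²` is discarded, which is the point where `q ≤ 1` enters.
  have C : ∀ j, σ * (hterm j + q * (t2 j / τ)) ≤ ∑ i, W i j * F i := by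
    intro j
    have h1 := (A j).2
    have h2 := esH_le (s := univ) (k := k + 1) (by omega) hG fun i => T i j
    have e1 : esD univ (k + 1) l (fun i => T i j) = ∑ i, T i j * F i := rfl
    rw [e1, ← hσ, (B j).1] at h2
    rw [add_div] at h1
    have h3 : hterm j + q * (t2 j / τ) ≤ (∑ i, W i j * F i) / σ := by
      nlinarith [mul_nonneg (sub_nonneg.2 hq) (sq_nonneg (b j))]
    rw [le_div_iff₀ hσ0] at h3
    linarith
  have hC := sum_le_sum fun j (_ : j ∈ Finset.univ) => C j
  rw [← Finset.mul_sum, sum_add_distrib, ← Finset.mul_sum, ← Finset.sum_div, G.sum_simons F] at hC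
  have hTsum : ∀ m, ∑ j, T j m = s1 * b m := fun m => by
    rw [← (B m).1, mul_div_cancel₀ _ hs0.ne']
  have hTF : ∀ m, ∑ j, T j m * F j = σ * (η m / h + q * b m) := fun m => by
    rw [← (A m).1, mul_div_cancel₀ _ hσ0.ne']
  have ht2sum : ∑ j, t2 j = -(τ * ∑ j, l j ^ 2) - s1 * ∑ m, b m * ε m := by
    simp only [ht2, sum_sub_distrib, sum_neg_distrib]
    rw [sum_comm, Finset.mul_sum, Finset.mul_sum]
    congr 1
    · congr 1
      exact sum_congr rfl fun j _ => by ring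
    · refine sum_congr rfl fun m _ => ?_
      rw [← Finset.sum_mul, hTsum]; ring
  have ht2F : ∑ i, F i * t2 i = -(τ * ∑ i, F i * l i ^ 2) - σ * ∑ m, (η m / h + q * b m) * ε m := by
    have : ∀ i, F i * t2 i = -(τ * (F i * l i ^ 2)) - ∑ m, (T i m * F i) * ε m := by
      intro i
      simp only [ht2, mul_sub, Finset.mul_sum]
      rw [show F i * -(l i ^ 2 * τ) = -(τ * (F i * l i ^ 2)) by ring]
      refine congrArg _ (Finset.sum_congr rfl fun m _ => ?_)
      ring
    simp only [this]
    rw [sum_sub_distrib, sum_neg_distrib, ← Finset.mul_sum, sum_comm,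
      Finset.mul_sum (a := σ)]
    congr 1
    refine sum_congr rfl fun m _ => ?_
    rw [← Finset.sum_mul, hTF]; ring
  have hD : ∑ i, F i * ∑ j, W j i ≤ s1 / τ * ∑ i, F i * t2 i := by
    rw [Finset.mul_sum]
    refine sum_le_sum fun i _ => ?_
    calc _ ≤ F i * (s1 * t2 i / τ) := mul_le_mul_of_nonneg_left (B i).2 (hF0 i).le
      _ = _ := by ring
  have hEuler : ∑ i, F i * l i = (k + 1) * σ := by
    rw [← sum_mul_es_erase]; exact sum_congr rfl fun i _ => mul_comm _ _
  rw [ht2F] at hD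
  rw [ht2sum, hEuler] at hC
  have hsplit : ∑ m, (η m / h + q * b m) * ε m = ∑ m, ε m * η m / h + q * ∑ m, b m * ε m := by
    rw [Finset.mul_sum, ← sum_add_distrib]
    exact sum_congr rfl fun m _ => by ring
  rw [hsplit] at hD
  -- The terms `σ₁ ∑ Fᵢλᵢ²` cancel here. The terms `q ∑ bₘεₘ` occur with the same factor on both
  -- sides and cancel at the end.
  have hfin : σ * ((∑ j, hterm j) + q * ((-(τ * ∑ j, l j ^ 2) - s1 * ∑ m, b m * ε m) / τ))
      ≤ σ * (-(s1 / τ * (∑ m, ε m * η m / h + q * ∑ m, b m * ε m)) - (k + 1) * ∑ j, l j ^ 2) := by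
    refine hC.trans ?_
    have e1 : s1 / τ * (-(τ * ∑ i, F i * l i ^ 2) -
        σ * (∑ m, ε m * η m / h + q * ∑ m, b m * ε m)) = -(s1 * ∑ i, F i * l i ^ 2)
        - σ * (s1 / τ * (∑ m, ε m * η m / h + q * ∑ m, b m * ε m)) := by
      field_simp
    rw [e1] at hD
    linarith
  have hfin := le_of_mul_le_mul_left hfin hσ0
  have e2 : (-(τ * ∑ j, l j ^ 2) - s1 * ∑ m, b m * ε m) / τ
      = -(∑ j, l j ^ 2) - s1 / τ * ∑ m, b m * ε m := by
    field_simp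
  rw [e2] at hfin
  push_cast
  linarith

end GraphJets

end CurvatureGraph

end

/-! ### The pointwise inequality for `k = 1`, and curvature bounds with explicit constants -/

noncomputable section

namespace CurvatureGraph

open Finset Filter Topology

namespace GraphJets

variable {n : ℕ} {l η ε : Fin n → ℝ} {T N : Fin n → Fin n → ℝ} {τ h θ : ℝ}
    {ζ : Fin n → ℝ} {d : Fin n → Fin n → ℝ → ℝ} {tau hh : Fin n → ℝ → ℝ}

/-- The trace of the shape operator is linear in its entries, so the equation holds exactly along
each axis and can be differentiated twice without concavity; `q` may be arbitrary. Simons' identity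
is contracted with `λ` itself in place of `F`. -/
theorem bound_of_one (G : GraphJets l η ε T N τ h θ ζ d tau hh) {q a : ℝ}
    (ha : a < τ) (hA : 0 < ∑ i, l i ^ 2) (heq0 : ∑ i, l i = h * τ ^ q)
    (heq : ∀ j, ∀ᶠ t in 𝓝 0, ∑ i, d j i t = hh j t * tau j t ^ q)
    (hmax : ∀ j, ∀ᶠ t in 𝓝 0, (∑ i, d j i t ^ 2) / (tau j t - a) ^ 2
      ≤ (∑ i, l i ^ 2) / (τ - a) ^ 2) :
    (∑ i, l i ^ 2) ^ 2 * (a / (τ - a)) ≤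
      -((∑ i, l i) * ∑ i, l i * ((η i / h + q * (-(l i * ε i) / τ)) ^ 2
          + ((ζ i + l i * θ) / h - (η i / h) ^ 2) - q * (-(l i * ε i) / τ) ^ 2))
      + (∑ i, l i) * (q / τ) * (τ * (∑ i, l i * l i ^ 2)
          + (∑ i, l i ^ 2) * ∑ m, ε m * (-(l m * ε m) / (τ - a)))
      - (∑ i, l i) * (∑ i, l i * l i ^ 2)
      - (∑ i, l i ^ 2) / (τ - a) * (∑ i, l i) *
          ∑ m, ε m * (η m / h + q * (-(l m * ε m) / τ)) := by
  set A := ∑ i, l i ^ 2 with hAdef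
  set s1 := ∑ i, l i with hs1
  have hτ := G.tau_pos
  have hh0 := G.h_pos
  have hta : 0 < τ - a := by linarith
  have hs0 : 0 < s1 := by rw [heq0]; exact mul_pos hh0 (Real.rpow_pos_of_pos hτ q)
  set W : Fin n → Fin n → ℝ := fun i j => N i j - l i * l j ^ 2 - 2 * (if i = j then l j ^ 3 else 0)
    with hW
  set t2 : Fin n → ℝ := fun j => -(l j ^ 2 * τ) - ∑ m, T j m * ε m with ht2
  set b : Fin n → ℝ := fun j => -(l j * ε j) / τ with hb
  set c : Fin n → ℝ := fun j => -(l j * ε j) / (τ - a) with hc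
  set α : Fin n → ℝ := fun j => η j / h + q * b j with hα
  set hterm : Fin n → ℝ := fun j => (ζ j + l j * θ) / h - (η j / h) ^ 2 with hterm_def
  have jsum : ∀ j, IsJet (fun t => ∑ i, d j i t) s1 (∑ i, T i j) (∑ i, W i j) := fun j =>
    IsJet.sum univ fun i _ => G.d_jet j i
  have jsq : ∀ j, IsJet (fun t => ∑ i, d j i t ^ 2) A (2 * ∑ i, l i * T i j)
      (2 * ∑ i, l i * W i j + 2 * ∑ i, T i j ^ 2) := fun j => by
    have := IsJet.sum univ fun i (_ : i ∈ Finset.univ) => (G.d_jet j i).mul (G.d_jet j i)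
    simp only [← pow_two] at this
    refine this.congr_val rfl ?_ ?_
    · rw [Finset.mul_sum]; exact sum_congr rfl fun i _ => by ring
    · rw [Finset.mul_sum, Finset.mul_sum, ← sum_add_distrib]
      refine sum_congr rfl fun i _ => ?_
      simp only [hW]; ring
  have jta : ∀ j, IsJet (fun t => tau j t - a) (τ - a) (-(l j * ε j)) (t2 j) := fun j =>
    ((G.tau_jet j).sub (IsJet.const a)).congr_val rfl (sub_zero _) (sub_zero _)
  have E : ∀ j, (∑ i, T i j) = s1 * α j ∧
      ∑ i, W i j = s1 * (α j ^ 2 + hterm j + q * (t2 j / τ - b j ^ 2)) := by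
    intro j
    have J1 := (jsum j).log hs0
    have J2 := ((G.h_jet j).log hh0).add (((G.tau_jet j).log hτ).const_mul q)
    have hev : (fun t => Real.log (∑ i, d j i t)) =ᶠ[𝓝 0]
        fun t => Real.log (hh j t) + q * Real.log (tau j t) := by
      filter_upwards [heq j, eventually_pos (G.tau_jet j) hτ, eventually_pos (G.h_jet j) hh0]
        with t h1 h2 h3
      rw [h1, Real.log_mul h3.ne' (Real.rpow_pos_of_pos h2 q).ne', Real.log_rpow h2]
    obtain ⟨-, u1, u2⟩ := J1.unique (J2.congr hev)
    have u1' : (∑ i, T i j) / s1 = α j := u1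
    rw [u1'] at u2
    refine ⟨by rw [← u1', mul_div_cancel₀ _ hs0.ne'], ?_⟩
    have u3 : (∑ i, W i j) / s1 = α j ^ 2 + hterm j + q * (t2 j / τ - b j ^ 2) := by linarith
    rw [← u3, mul_div_cancel₀ _ hs0.ne']
  have B : ∀ j, ∑ i, l i * T i j = A * c j ∧ ∑ i, l i * W i j ≤ A * t2 j / (τ - a) := by
    intro j
    have J := ((jsq j).log hA).sub (((jta j).log hta).const_mul 2)
    have hM : ∀ᶠ t in 𝓝 0, Real.log (∑ i, d j i t ^ 2) - 2 * Real.log (tau j t - a)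
        ≤ Real.log A - 2 * Real.log (τ - a) := by
      filter_upwards [hmax j, eventually_pos (jta j) hta, eventually_pos (jsq j) hA]
        with t h1 h2 h3
      have e : ∀ x : ℝ, 2 * Real.log x = Real.log (x ^ 2) := fun x => by
        rw [Real.log_pow]; norm_num
      rw [e, e, ← Real.log_div h3.ne' (pow_pos h2 2).ne', ← Real.log_div hA.ne' (pow_pos hta 2).ne']
      exact Real.log_le_log (div_pos h3 (pow_pos h2 2)) h1
    obtain ⟨J1, J2⟩ := J.of_eventually_le hM
    have J1' : (2 * ∑ i, l i * T i j) / A = 2 * c j := by simp only [hc]; linarith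
    have hTc : ∑ i, l i * T i j = A * c j := by
      rw [div_eq_iff hA.ne'] at J1'; linarith
    refine ⟨hTc, ?_⟩
    have J2' : (2 * ∑ i, l i * W i j + 2 * ∑ i, T i j ^ 2) / A - (2 * c j) ^ 2 -
        2 * (t2 j / (τ - a) - c j ^ 2) ≤ 0 := by rw [← J1']; exact J2
    -- Differentiating `log |A|²` twice produces `-4c²`, and the denominator contributes `+2c²`.
    -- Cauchy–Schwarz on the squared third derivatives supplies the missing `2c²`.
    have CS : (A * c j) ^ 2 ≤ A * ∑ i, T i j ^ 2 := by
      rw [← hTc]; exact sum_mul_sq_le_sq_mul_sq univ _ _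
    have CS' : A * c j ^ 2 ≤ ∑ i, T i j ^ 2 :=
      le_of_mul_le_mul_left (by linarith [CS, show A * (A * c j ^ 2) = (A * c j) ^ 2 by ring]) hA
    have J3 : (2 * ∑ i, l i * W i j + 2 * ∑ i, T i j ^ 2) / A
        ≤ 2 * (t2 j / (τ - a)) + 2 * c j ^ 2 := by linarith
    rw [div_le_iff₀ hA] at J3
    have e : A * t2 j / (τ - a) = A * (t2 j / (τ - a)) := by ring
    rw [e]
    linarith
  have S := sum_le_sum fun j (_ : j ∈ Finset.univ) => (B j).right
  have hcomm : ∑ j, ∑ i, l i * W i j = ∑ j, ∑ i, W i j * l i :=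
    sum_congr rfl fun j _ => sum_congr rfl fun i _ => mul_comm _ _
  rw [hcomm, G.sum_simons l, ← Finset.sum_div, ← Finset.mul_sum] at S
  have ht2sum : ∑ j, t2 j = -(τ * A) - s1 * ∑ m, ε m * α m := by
    simp only [ht2, sum_sub_distrib, sum_neg_distrib]
    rw [sum_comm, hAdef, Finset.mul_sum, Finset.mul_sum]
    congr 1
    · congr 1
      exact sum_congr rfl fun j _ => by ring
    · refine sum_congr rfl fun m _ => ?_
      rw [← Finset.sum_mul, (E m).1]; ring
  have ht2l : ∑ i, l i * t2 i = -(τ * ∑ i, l i * l i ^ 2) - A * ∑ m, ε m * c m := by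
    have : ∀ i, l i * t2 i = -(τ * (l i * l i ^ 2)) - ∑ m, (l i * T i m) * ε m := by
      intro i
      simp only [ht2, mul_sub, Finset.mul_sum]
      rw [show l i * -(l i ^ 2 * τ) = -(τ * (l i * l i ^ 2)) by ring]
      refine congrArg _ (Finset.sum_congr rfl fun m _ => ?_)
      ring
    simp only [this]
    rw [sum_sub_distrib, sum_neg_distrib, ← Finset.mul_sum, sum_comm, Finset.mul_sum (a := A)]
    congr 1
    refine sum_congr rfl fun m _ => ?_
    rw [← Finset.sum_mul, (B m).1]; ring
  have hψ : ∑ i, l i * ∑ j, W j i = s1 * (∑ i, l i * (α i ^ 2 + hterm i - q * b i ^ 2))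
      + s1 * (q / τ) * ∑ i, l i * t2 i := by
    rw [Finset.mul_sum, Finset.mul_sum, ← sum_add_distrib]
    refine sum_congr rfl fun i _ => ?_
    rw [(E i).2]; ring
  have hψ' : ∑ i, l i * ∑ j, W j i = ∑ i, l i * ∑ j, (N j i - l j * l i ^ 2
      - 2 * (if j = i then l i ^ 3 else 0)) := rfl
  have hll : ∑ i, l i * l i = A := sum_congr rfl fun i _ => (pow_two _).symm
  rw [← hψ', hψ, ht2l, ht2sum, hll] at S
  -- Since `τ/(τ-a) = 1 + a/(τ-a)`, the term `-A²` cancels the one from Simons' identity and the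
  -- shift leaves `A² a/(τ-a)`.
  have e1 : A * (-(τ * A) - s1 * ∑ m, ε m * α m) / (τ - a)
      = -(A ^ 2 * (a / (τ - a))) - A ^ 2 - A / (τ - a) * s1 * ∑ m, ε m * α m := by
    field_simp; ring
  rw [e1] at S
  linarith

/-- The a priori bounds on the data of the equation at a point. -/
structure Bounds (τ₀ h₀ K : ℝ) (η ε ζ : Fin n → ℝ) (τ h θ : ℝ) : Prop where
  tau_ge : τ₀ ≤ τ
  tau_le : τ ≤ 1
  h_ge : h₀ ≤ h
  h_le : h ≤ K
  eps : ∀ i, |ε i| ≤ 1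
  eta : ∀ i, |η i| ≤ K
  zeta : ∀ i, |ζ i| ≤ K
  theta : |θ| ≤ K

theorem abs_sum_le {f : Fin n → ℝ} {B : ℝ} (h : ∀ i, |f i| ≤ B) : |∑ i, f i| ≤ n * B := by
  refine (abs_sum_le_sum_abs _ _).trans ((sum_le_sum fun i _ => h i).trans ?_)
  simp

theorem abs_le_sqrt_sum (l : Fin n → ℝ) (i : Fin n) : |l i| ≤ √(∑ j, l j ^ 2) :=
  Real.abs_le_sqrt (single_le_sum (f := fun j => l j ^ 2) (fun _ _ => sq_nonneg _) (mem_univ i))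

theorem abs_mul_le {x y a b : ℝ} (hx : |x| ≤ a) (hy : |y| ≤ b) : |x * y| ≤ a * b := by
  rw [abs_mul]; exact mul_le_mul hx hy (abs_nonneg _) ((abs_nonneg _).trans hx)

theorem abs_div_le {x y a b : ℝ} (hx : |x| ≤ a) (hb : 0 < b) (hy : b ≤ y) : |x / y| ≤ a / b := by
  rw [abs_div, abs_of_pos (hb.trans_le hy)]
  exact div_le_div₀ ((abs_nonneg _).trans hx) hx hb hy

theorem abs_add_le' {x y a b : ℝ} (hx : |x| ≤ a) (hy : |y| ≤ b) : |x + y| ≤ a + b :=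
  (abs_add_le x y).trans (add_le_add hx hy)

theorem abs_sub_le' {x y a b : ℝ} (hx : |x| ≤ a) (hy : |y| ≤ b) : |x - y| ≤ a + b :=
  (abs_sub x y).trans (add_le_add hx hy)

theorem abs_sq_le {x a : ℝ} (hx : |x| ≤ a) : |x ^ 2| ≤ a ^ 2 := by
  rw [abs_pow]; exact pow_le_pow_left₀ (abs_nonneg _) hx 2

theorem abs_hterm_le {τ₀ h₀ K r : ℝ} (hB : Bounds τ₀ h₀ K η ε ζ τ h θ) (hh₀ : 0 < h₀)
    {i : Fin n} (hl : |l i| ≤ r) :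
    |(ζ i + l i * θ) / h - (η i / h) ^ 2| ≤ (K + r * K) / h₀ + (K / h₀) ^ 2 :=
  abs_sub_le' (abs_div_le (abs_add_le' (hB.zeta i) (abs_mul_le hl hB.theta)) hh₀ hB.h_ge)
    (abs_sq_le (abs_div_le (hB.eta i) hh₀ hB.h_ge))

theorem exists_bound_of_two_le (n k : ℕ) {q τ₀ h₀ : ℝ} (K : ℝ) (hk : 2 ≤ k) (hq : q ≤ 1)
    (hτ₀ : 0 < τ₀) (hh₀ : 0 < h₀) :
    ∃ C : ℝ, ∀ (l η ε : Fin n → ℝ) (T N : Fin n → Fin n → ℝ) (τ h θ : ℝ) (ζ : Fin n → ℝ)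
      (d : Fin n → Fin n → ℝ → ℝ) (tau hh : Fin n → ℝ → ℝ),
      GraphJets l η ε T N τ h θ ζ d tau hh → Bounds τ₀ h₀ K η ε ζ τ h θ →
      Gam univ k l → es univ k l = h * τ ^ q →
      (∀ j, ∀ᶠ t in 𝓝 0, hh j t * tau j t ^ q ≤ es univ k fun i => d j i t) →
      (∀ j, ∀ᶠ t in 𝓝 0, (∑ i, d j i t) / tau j t ≤ (∑ i, l i) / τ) →
      √(∑ i, l i ^ 2) ≤ C := by
  have hkq : 0 < (k : ℝ) - q := by
    have : (2 : ℝ) ≤ k := by exact_mod_cast hk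
    linarith
  -- For `r = |A| ≥ 1` each lower order term is at most a constant times `r`; the second entry is
  -- the sum of these constants over `k - q`.
  refine ⟨max 1 ((n * 1 / τ₀ * (n * (1 * K / h₀)) + n * ((K + K) / h₀ + (K / h₀) ^ 2)) / (k - q)), ?_⟩
  intro l η ε T N τ h θ ζ d tau hh G hB hG heq hle hmax
  set r := √(∑ i, l i ^ 2) with hr
  rcases le_total r 1 with h1 | h1
  · exact h1.trans (le_max_left _ _)
  refine le_trans ?_ (le_max_right _ _)
  rw [le_div_iff₀ hkq]
  have hr2 : r ^ 2 = ∑ i, l i ^ 2 := Real.sq_sqrt (sum_nonneg fun i _ => sq_nonneg _)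
  have hl : ∀ i, |l i| ≤ r := abs_le_sqrt_sum l
  have hr0 : 0 < r := by linarith
  have hK : 0 < K := hh₀.trans_le (hB.h_ge.trans hB.h_le)
  have key := G.bound_of_two_le (by omega) hq hG heq hle hmax
  have b1 : |(∑ i, l i) / τ * ∑ m, ε m * η m / h| ≤ n * r / τ₀ * (n * (1 * K / h₀)) :=
    abs_mul_le (abs_div_le (abs_sum_le hl) hτ₀ hB.tau_ge) (abs_sum_le fun m =>
      abs_div_le (abs_mul_le (hB.eps m) (hB.eta m)) hh₀ hB.h_ge)
  have b2 : |∑ j, ((ζ j + l j * θ) / h - (η j / h) ^ 2)| ≤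
      n * ((K + r * K) / h₀ + (K / h₀) ^ 2) :=
    abs_sum_le fun j => abs_hterm_le hB hh₀ (hl j)
  have b3 : (K + r * K) / h₀ + (K / h₀) ^ 2 ≤ r * ((K + K) / h₀ + (K / h₀) ^ 2) := by
    rw [mul_add, mul_div_assoc']
    refine add_le_add ?_ (le_mul_of_one_le_left (sq_nonneg _) h1)
    exact div_le_div_of_nonneg_right (by nlinarith) hh₀.le
  have b4 := mul_le_mul_of_nonneg_left b3 (Nat.cast_nonneg (α := ℝ) n)
  rw [← hr2] at key
  have b1' := (neg_le_abs _).trans b1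
  have b2' := (neg_le_abs _).trans b2
  refine le_of_mul_le_mul_left ?_ hr0
  calc r * (r * (k - q)) = (k - q) * r ^ 2 := by ring
    _ ≤ n * r / τ₀ * (n * (1 * K / h₀)) + n * (r * ((K + K) / h₀ + (K / h₀) ^ 2)) := by linarith
    _ = _ := by ring

theorem exists_bound_of_one (n : ℕ) (q : ℝ) {τ₀ h₀ : ℝ} (K : ℝ) (hτ₀ : 0 < τ₀) (hh₀ : 0 < h₀) :
    ∃ C : ℝ, ∀ (l η ε : Fin n → ℝ) (T N : Fin n → Fin n → ℝ) (τ h θ : ℝ) (ζ : Fin n → ℝ)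
      (d : Fin n → Fin n → ℝ → ℝ) (tau hh : Fin n → ℝ → ℝ),
      GraphJets l η ε T N τ h θ ζ d tau hh → Bounds τ₀ h₀ K η ε ζ τ h θ →
      ∑ i, l i = h * τ ^ q →
      (∀ j, ∀ᶠ t in 𝓝 0, ∑ i, d j i t = hh j t * tau j t ^ q) →
      (∀ j, ∀ᶠ t in 𝓝 0, (∑ i, d j i t ^ 2) / (tau j t - τ₀ / 2) ^ 2
        ≤ (∑ i, l i ^ 2) / (τ - τ₀ / 2) ^ 2) →
      √(∑ i, l i ^ 2) ≤ C := by
  set S : ℝ := K * max 1 (τ₀ ^ q) with hS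
  set α : ℝ := K / h₀ + |q| * (1 * 1 / τ₀) with hα
  set β : ℝ := (K + K) / h₀ + (K / h₀) ^ 2 with hβ
  -- `S` bounds `σ₁ = H τ^q`, so no power of `r` is spent on it. The four summands are the
  -- coefficients of `r³` in the four groups of `bound_of_one`, and `τ₀/2` is a lower bound for
  -- `a/(τ-a)`, as `τ - a ≤ 1`.
  refine ⟨max 1 ((S * (n * (1 * (α ^ 2 + β + |q| * (1 * 1 / τ₀) ^ 2)))
    + S * (|q| / τ₀) * (1 * (n * (1 * 1 ^ 2)) + 1 * (n * (1 * (1 * 1 / (τ₀ / 2)))))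
    + S * (n * (1 * 1 ^ 2)) + 1 / (τ₀ / 2) * S * (n * (1 * α))) / (τ₀ / 2)), ?_⟩
  intro l η ε T N τ h θ ζ d tau hh G hB heq0 heq hmax
  set r := √(∑ i, l i ^ 2) with hr
  rcases le_total r 1 with h1 | h1
  · exact h1.trans (le_max_left _ _)
  refine le_trans ?_ (le_max_right _ _)
  rw [le_div_iff₀ (by positivity)]
  have hr2 : ∑ i, l i ^ 2 = r ^ 2 := (Real.sq_sqrt (sum_nonneg fun i _ => sq_nonneg _)).symm
  have hl : ∀ i, |l i| ≤ r := abs_le_sqrt_sum l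
  have hr0 : 0 < r := by linarith
  have hK : 0 < K := hh₀.trans_le (hB.h_ge.trans hB.h_le)
  have hta : τ₀ / 2 ≤ τ - τ₀ / 2 := by linarith [hB.tau_ge]
  have key := G.bound_of_one (a := τ₀ / 2) (by linarith [hB.tau_ge]) (by rw [hr2]; positivity)
    heq0 heq hmax
  have hσ : |∑ i, l i| ≤ S := by
    rw [heq0, abs_of_nonneg (mul_nonneg G.h_pos.le (Real.rpow_nonneg G.tau_pos.le q))]
    refine mul_le_mul hB.h_le ?_ (Real.rpow_nonneg G.tau_pos.le q) hK.le
    rcases le_total 0 q with hq | hq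
    · exact (Real.rpow_le_one G.tau_pos.le hB.tau_le hq).trans (le_max_left _ _)
    · exact (Real.rpow_le_rpow_of_nonpos hτ₀ hB.tau_ge hq).trans (le_max_right _ _)
  have hS0 : 0 ≤ S := (abs_nonneg _).trans hσ
  have hα0 : 0 ≤ α := by positivity
  have hβ0 : 0 ≤ β := by positivity
  have hb : ∀ i, |(-(l i * ε i) / τ)| ≤ r * 1 / τ₀ := fun i =>
    abs_div_le (by rw [abs_neg]; exact abs_mul_le (hl i) (hB.eps i)) hτ₀ hB.tau_ge
  have hc : ∀ i, |(-(l i * ε i) / (τ - τ₀ / 2))| ≤ r * 1 / (τ₀ / 2) := fun i =>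
    abs_div_le (by rw [abs_neg]; exact abs_mul_le (hl i) (hB.eps i)) (by positivity) hta
  have hαi : ∀ i, |η i / h + q * (-(l i * ε i) / τ)| ≤ α * r := fun i => by
    refine (abs_add_le' (abs_div_le (hB.eta i) hh₀ hB.h_ge) (abs_mul_le le_rfl (hb i))).trans ?_
    have : K / h₀ ≤ K / h₀ * r := le_mul_of_one_le_right (by positivity) h1
    calc _ ≤ K / h₀ * r + |q| * (r * 1 / τ₀) := by linarith
      _ = _ := by rw [hα]; ring
  have hht : ∀ i, |(ζ i + l i * θ) / h - (η i / h) ^ 2| ≤ β * r ^ 2 := fun i => by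
    refine (abs_hterm_le hB hh₀ (hl i)).trans ?_
    have hr1 : 1 ≤ r ^ 2 := by nlinarith
    rw [hβ, add_mul, div_mul_eq_mul_div]
    refine add_le_add ?_ (le_mul_of_one_le_right (sq_nonneg _) hr1)
    have hr3 : r ≤ r ^ 2 := by nlinarith
    have := mul_le_mul_of_nonneg_left hr1 hK.le
    have := mul_le_mul_of_nonneg_left hr3 hK.le
    exact div_le_div_of_nonneg_right (by linarith) hh₀.le
  have hl3 : ∀ i, |l i * l i ^ 2| ≤ r * r ^ 2 := fun i => abs_mul_le (hl i) (abs_sq_le (hl i))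
  have hrr : |r ^ 2| ≤ r ^ 2 := (abs_of_nonneg (sq_nonneg r)).le
  have hττ : |τ| ≤ 1 := by rw [abs_of_pos G.tau_pos]; exact hB.tau_le
  have b1 := abs_mul_le hσ (abs_sum_le fun i => abs_mul_le (hl i) (abs_sub_le'
    (abs_add_le' (abs_sq_le (hαi i)) (hht i)) (abs_mul_le (le_refl |q|) (abs_sq_le (hb i)))))
  have b2 := abs_mul_le (abs_mul_le hσ (abs_div_le (le_refl |q|) hτ₀ hB.tau_ge))
    (abs_add_le' (abs_mul_le hττ (abs_sum_le hl3))
      (abs_mul_le hrr (abs_sum_le fun m => abs_mul_le (hB.eps m) (hc m))))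
  have b3 := abs_mul_le hσ (abs_sum_le hl3)
  have b4 := abs_mul_le (abs_mul_le (abs_div_le hrr (by positivity) hta) hσ)
    (abs_sum_le fun m => abs_mul_le (hB.eps m) (hαi m))
  have b1' := (neg_le_abs _).trans b1
  have b2' := (le_abs_self _).trans b2
  have b3' := (neg_le_abs _).trans b3
  have b4' := (neg_le_abs _).trans b4
  rw [hr2] at key
  have hL : r ^ 4 * (τ₀ / 2) ≤ (r ^ 2) ^ 2 * (τ₀ / 2 / (τ - τ₀ / 2)) := by
    rw [← pow_mul]
    refine mul_le_mul_of_nonneg_left ?_ (by positivity)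
    exact le_div_self (by positivity) (by linarith) (by linarith [hB.tau_le])
  refine le_of_mul_le_mul_left ?_ (pow_pos hr0 3)
  calc r ^ 3 * (r * (τ₀ / 2)) = r ^ 4 * (τ₀ / 2) := by ring
    _ ≤ _ := hL.trans key
    _ ≤ _ := add_le_add (add_le_add (add_le_add b1' b2') b3') b4'
    _ = _ := by ring

end GraphJets

end CurvatureGraph

end

noncomputable section

namespace CurvatureGraph

open Finset Matrix

variable {n : ℕ}

/-! ### Frames of the tangent space of a graph -/

theorem eq_sum_smul_e (v : E n) : v = ∑ a, v a • e a := by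
  have := (EuclideanSpace.basisFun (Fin n) ℝ).sum_repr v
  simpa [e] using this.symm

theorem apply_eq_sum (p : E n →L[ℝ] ℝ) (v : E n) : p v = ∑ a, v a * p (e a) := by
  conv_lhs => rw [eq_sum_smul_e v]
  simp

theorem apply_apply_eq_sum (B : E n →L[ℝ] E n →L[ℝ] ℝ) (v u : E n) :
    B v u = ∑ a, ∑ b, v a * u b * B (e a) (e b) := by
  conv_lhs => rw [eq_sum_smul_e v]
  simp only [map_sum, map_smul, _root_.sum_apply, _root_.smul_apply,
    smul_eq_mul]
  refine sum_congr rfl fun a _ => ?_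
  rw [apply_eq_sum, Finset.mul_sum]
  exact sum_congr rfl fun b _ => by ring

/-- The vector representing a continuous linear form. -/
def grad (p : E n →L[ℝ] ℝ) : E n := (InnerProductSpace.toDual ℝ (E n)).symm p

theorem inner_grad (p : E n →L[ℝ] ℝ) (v : E n) : inner ℝ (grad p) v = p v := by
  simp [grad]

theorem norm_grad (p : E n →L[ℝ] ℝ) : ‖grad p‖ = ‖p‖ := by simp [grad]

theorem grad_apply (p : E n →L[ℝ] ℝ) (a : Fin n) : grad p a = p (e a) := by
  rw [← inner_grad, e, EuclideanSpace.inner_single_right]; simp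

theorem norm_sq_eq_sum (p : E n →L[ℝ] ℝ) : ‖p‖ ^ 2 = ∑ a, p (e a) ^ 2 := by
  rw [← norm_grad, EuclideanSpace.norm_sq_eq]; simp [grad_apply]

theorem apply_grad (p : E n →L[ℝ] ℝ) : p (grad p) = ‖p‖ ^ 2 := by
  rw [← inner_grad, real_inner_self_eq_norm_sq, norm_grad]

/-- The induced metric of the graph as a bilinear form. -/
def met (p : E n →L[ℝ] ℝ) (u v : E n) : ℝ := inner ℝ u v + p u * p v

theorem met_comm (p : E n →L[ℝ] ℝ) (u v : E n) : met p u v = met p v u := by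
  rw [met, met, real_inner_comm, mul_comm]

theorem met_add_left (p : E n →L[ℝ] ℝ) (u u' v : E n) :
    met p (u + u') v = met p u v + met p u' v := by
  simp only [met, inner_add_left, map_add]; ring

theorem met_smul_left (p : E n →L[ℝ] ℝ) (r : ℝ) (u v : E n) :
    met p (r • u) v = r * met p u v := by
  simp only [met, real_inner_smul_left, map_smul, smul_eq_mul]; ring

theorem met_sum_left {ι : Type*} (p : E n →L[ℝ] ℝ) (s : Finset ι) (f : ι → E n) (v : E n) :
    met p (∑ i ∈ s, f i) v = ∑ i ∈ s, met p (f i) v := by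
  simp only [met, sum_inner, map_sum, Finset.sum_mul, sum_add_distrib]

theorem met_add_right (p : E n →L[ℝ] ℝ) (u v v' : E n) :
    met p u (v + v') = met p u v + met p u v' := by
  simp only [met_comm p u, met_add_left]

theorem met_smul_right (p : E n →L[ℝ] ℝ) (r : ℝ) (u v : E n) :
    met p u (r • v) = r * met p u v := by
  simp only [met_comm p u, met_smul_left]

theorem met_sum_right {ι : Type*} (p : E n →L[ℝ] ℝ) (s : Finset ι) (f : ι → E n) (u : E n) :
    met p u (∑ i ∈ s, f i) = ∑ i ∈ s, met p u (f i) := by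
  simp only [met_comm p u, met_sum_left]

theorem met_eq_sum (p : E n →L[ℝ] ℝ) (u v : E n) :
    met p u v = ∑ a, ∑ b, u a * v b * firstForm p a b := by
  rw [met, apply_eq_sum p u, apply_eq_sum p v, PiLp.inner_apply, Finset.sum_mul_sum,
    ← sum_add_distrib]
  refine sum_congr rfl fun a _ => ?_
  simp only [firstForm, Matrix.of_apply, mul_add, sum_add_distrib, mul_ite, mul_one, mul_zero,
    sum_ite_eq, Finset.mem_univ, if_true]
  congr 1
  · simp [mul_comm]
  · exact sum_congr rfl fun b _ => by ring

/-- A frame is orthonormal for the induced metric. -/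
def IsFrame (p : E n →L[ℝ] ℝ) (v : Fin n → E n) : Prop :=
  ∀ i j, met p (v i) (v j) = if i = j then 1 else 0

/-- The matrix of the second fundamental form in a frame. -/
def frameForm (p : E n →L[ℝ] ℝ) (B : E n →L[ℝ] E n →L[ℝ] ℝ) (v : Fin n → E n) :
    Matrix (Fin n) (Fin n) ℝ :=
  Matrix.of fun i j => B (v i) (v j) / √(1 + ‖p‖ ^ 2)

/-- The matrix whose columns are the vectors of a frame. -/
def frameMatrix (v : Fin n → E n) : Matrix (Fin n) (Fin n) ℝ := Matrix.of fun a i => v i a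

theorem transpose_mul_firstForm_mul (p : E n →L[ℝ] ℝ) {v : Fin n → E n} (hv : IsFrame p v) :
    (frameMatrix v)ᵀ * firstForm p * frameMatrix v = 1 := by
  ext i j
  rw [Matrix.one_apply, ← hv i j, met_eq_sum, Matrix.mul_apply]
  simp only [Matrix.mul_apply, Matrix.transpose_apply, frameMatrix, Matrix.of_apply, Finset.sum_mul]
  rw [sum_comm]
  exact sum_congr rfl fun a _ => sum_congr rfl fun b _ => by ring

theorem transpose_mul_secondForm_mul (p : E n →L[ℝ] ℝ) (B : E n →L[ℝ] E n →L[ℝ] ℝ)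
    (v : Fin n → E n) :
    (frameMatrix v)ᵀ * secondForm p B * frameMatrix v = frameForm p B v := by
  ext i j
  rw [frameForm, Matrix.of_apply, apply_apply_eq_sum, Matrix.mul_apply]
  simp only [Matrix.mul_apply, Matrix.transpose_apply, frameMatrix, Matrix.of_apply, Finset.sum_mul,
    secondForm, Finset.sum_div]
  rw [sum_comm]
  exact sum_congr rfl fun a _ => sum_congr rfl fun b _ => by ring

theorem frameMatrix_mul_transpose_mul (p : E n →L[ℝ] ℝ) {v : Fin n → E n} (hv : IsFrame p v) :
    frameMatrix v * ((frameMatrix v)ᵀ * firstForm p) = 1 :=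
  mul_eq_one_comm.1 (transpose_mul_firstForm_mul p hv)

theorem inv_firstForm_eq (p : E n →L[ℝ] ℝ) {v : Fin n → E n} (hv : IsFrame p v) :
    (firstForm p)⁻¹ = frameMatrix v * (frameMatrix v)ᵀ :=
  Matrix.inv_eq_left_inv (by rw [Matrix.mul_assoc]; exact frameMatrix_mul_transpose_mul p hv)

/-- The matrix `V` of an orthonormal frame has inverse `Vᵀ` times the metric, so this is a
similarity. The characteristic polynomial and traces can therefore be read off the symmetric matrix
`frameForm`. -/
theorem shapeOperator_eq (p : E n →L[ℝ] ℝ) (B : E n →L[ℝ] E n →L[ℝ] ℝ) {v : Fin n → E n}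
    (hv : IsFrame p v) :
    shapeOperator p B =
      frameMatrix v * frameForm p B v * ((frameMatrix v)ᵀ * firstForm p) := by
  have h := frameMatrix_mul_transpose_mul p hv
  rw [shapeOperator, inv_firstForm_eq p hv, ← transpose_mul_secondForm_mul]
  simp only [Matrix.mul_assoc] at h ⊢
  rw [h, Matrix.mul_one]

theorem charpoly_shapeOperator (p : E n →L[ℝ] ℝ) (B : E n →L[ℝ] E n →L[ℝ] ℝ) {v : Fin n → E n}
    (hv : IsFrame p v) : (shapeOperator p B).charpoly = (frameForm p B v).charpoly := by
  rw [shapeOperator_eq p B hv, Matrix.charpoly_mul_comm, ← Matrix.mul_assoc,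
    transpose_mul_firstForm_mul p hv, Matrix.one_mul]

theorem trace_shapeOperator (p : E n →L[ℝ] ℝ) (B : E n →L[ℝ] E n →L[ℝ] ℝ) {v : Fin n → E n}
    (hv : IsFrame p v) : (shapeOperator p B).trace = (frameForm p B v).trace := by
  rw [shapeOperator_eq p B hv, Matrix.trace_mul_comm, ← Matrix.mul_assoc,
    transpose_mul_firstForm_mul p hv, Matrix.one_mul]

theorem trace_shapeOperator_sq (p : E n →L[ℝ] ℝ) (B : E n →L[ℝ] E n →L[ℝ] ℝ) {v : Fin n → E n}
    (hv : IsFrame p v) :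
    (shapeOperator p B * shapeOperator p B).trace = (frameForm p B v * frameForm p B v).trace := by
  have h : (frameMatrix v)ᵀ * (firstForm p * frameMatrix v) = 1 := by
    rw [← Matrix.mul_assoc]; exact transpose_mul_firstForm_mul p hv
  have : shapeOperator p B * shapeOperator p B = frameMatrix v * (frameForm p B v * frameForm p B v)
      * ((frameMatrix v)ᵀ * firstForm p) := by
    rw [shapeOperator_eq p B hv]
    simp only [Matrix.mul_assoc]
    congr 2
    rw [← Matrix.mul_assoc (firstForm p), ← Matrix.mul_assoc (frameMatrix v)ᵀ, h, Matrix.one_mul]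
  rw [this, Matrix.trace_mul_comm, ← Matrix.mul_assoc, transpose_mul_firstForm_mul p hv,
    Matrix.one_mul]

theorem principalCurvatures_of_diagonal (p : E n →L[ℝ] ℝ) {B : E n →L[ℝ] E n →L[ℝ] ℝ}
    {v : Fin n → E n} (hv : IsFrame p v) {l : Fin n → ℝ}
    (hl : frameForm p B v = Matrix.diagonal l) :
    principalCurvatures p B = Finset.univ.val.map l := by
  rw [principalCurvatures, charpoly_shapeOperator p B hv, hl, Matrix.charpoly_diagonal]
  exact Polynomial.roots_multiset_prod_X_sub_C (Finset.univ.val.map l) |> fun h => by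
    rwa [Multiset.map_map] at h

theorem frameForm_isHermitian (p : E n →L[ℝ] ℝ) {B : E n →L[ℝ] E n →L[ℝ] ℝ}
    (hB : ∀ u v, B u v = B v u) (v : Fin n → E n) : (frameForm p B v).IsHermitian := by
  ext i j
  simp [frameForm, hB (v j) (v i)]

theorem principalCurvatures_eq (p : E n →L[ℝ] ℝ) {B : E n →L[ℝ] E n →L[ℝ] ℝ}
    (hB : ∀ u v, B u v = B v u) {v : Fin n → E n} (hv : IsFrame p v) :
    principalCurvatures p B = Finset.univ.val.map (frameForm_isHermitian p hB v).eigenvalues := by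
  rw [principalCurvatures, charpoly_shapeOperator p B hv,
    (frameForm_isHermitian p hB v).roots_charpoly_eq_eigenvalues]
  simp

theorem esymm_principalCurvatures (p : E n →L[ℝ] ℝ) {B : E n →L[ℝ] E n →L[ℝ] ℝ}
    (hB : ∀ u v, B u v = B v u) {v : Fin n → E n} (hv : IsFrame p v) (k : ℕ) :
    (principalCurvatures p B).esymm k
      = es Finset.univ k (frameForm_isHermitian p hB v).eigenvalues := by
  rw [principalCurvatures_eq p hB hv, Finset.esymm_map_val]; rfl

theorem normA_sq (p : E n →L[ℝ] ℝ) {B : E n →L[ℝ] E n →L[ℝ] ℝ}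
    (hB : ∀ u v, B u v = B v u) {v : Fin n → E n} (hv : IsFrame p v) :
    normA p B ^ 2 = ∑ i, ∑ j, frameForm p B v i j ^ 2 := by
  have h : (shapeOperator p B * shapeOperator p B).trace = ∑ i, ∑ j, frameForm p B v i j ^ 2 := by
    rw [trace_shapeOperator_sq p B hv, Matrix.trace]
    refine sum_congr rfl fun i _ => ?_
    rw [Matrix.diag_apply, Matrix.mul_apply]
    refine sum_congr rfl fun j _ => ?_
    rw [frameForm, Matrix.of_apply, Matrix.of_apply, hB (v j) (v i), pow_two (_ / _)]
  rw [normA, h]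
  exact Real.sq_sqrt (sum_nonneg fun i _ => sum_nonneg fun j _ => sq_nonneg _)

/-- The coefficients are those of `(1 + c cᵀ)^(-1/2) = 1 - c cᵀ/(W(1+W))`. It is used for the
standard basis, whose metric is `δ + pᵢpⱼ`, and for the coordinate frame of a graph over its tangent
plane. -/
theorem IsFrame.correct {p : E n →L[ℝ] ℝ} {v : Fin n → E n} {c : Fin n → ℝ} {W : ℝ}
    (hv : ∀ i j, met p (v i) (v j) = (if i = j then 1 else 0) + c i * c j)
    (hW : 0 < W) (hW2 : W ^ 2 = 1 + ∑ i, c i ^ 2) :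
    IsFrame p fun i => v i + (-(c i / (W * (1 + W)))) • ∑ j, c j • v j := by
  intro i j
  set u := ∑ j, c j • v j with hu
  have h1 : ∀ i, met p (v i) u = c i * W ^ 2 := by
    intro i
    simp only [hu, met_sum_right, met_smul_right, hv, mul_add, sum_add_distrib, mul_ite, mul_one,
      mul_zero, sum_ite_eq, Finset.mem_univ, if_true, hW2, Finset.mul_sum]
    congr 1
    exact sum_congr rfl fun j _ => by ring
  have h2 : met p u u = (W ^ 2 - 1) * W ^ 2 := by
    rw [show W ^ 2 - 1 = ∑ i, c i ^ 2 by linarith, Finset.sum_mul]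
    conv_lhs => rw [hu, met_sum_left]
    refine sum_congr rfl fun j _ => ?_
    rw [met_smul_left, h1]; ring
  rw [met_add_left, met_add_right, met_add_right, met_smul_left, met_smul_left, met_smul_right,
    met_smul_right, h1, met_comm p u (v j), h1, h2, hv]
  field_simp
  ring

/-- A frame which is orthonormal for the induced metric and diagonalizes the second form. -/
theorem exists_frame (p : E n →L[ℝ] ℝ) {B : E n →L[ℝ] E n →L[ℝ] ℝ} (hB : ∀ u v, B u v = B v u) :
    ∃ (v : Fin n → E n) (l : Fin n → ℝ), IsFrame p v ∧ frameForm p B v = Matrix.diagonal l := by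
  have h0 : ∃ r : Fin n → E n, IsFrame p r := by
    refine ⟨_, IsFrame.correct (v := fun i => e i) (c := fun i => p (e i)) (W := √(1 + ‖p‖ ^ 2))
      (fun i j => ?_) (by positivity) (by rw [Real.sq_sqrt (by positivity), norm_sq_eq_sum])⟩
    rw [met, e, e, EuclideanSpace.inner_single_left]
    simp
  obtain ⟨r, hr⟩ := h0
  have hA := frameForm_isHermitian p hB r
  have hU := hA.eigenvectorUnitary.2
  have hsp := hA.spectral_theorem
  set U : Matrix (Fin n) (Fin n) ℝ := (hA.eigenvectorUnitary : Matrix (Fin n) (Fin n) ℝ) with hUdef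
  have h2 : star U * U = 1 := Unitary.star_mul_self_of_mem hU
  rw [Unitary.conjStarAlgAut_apply, ← hUdef] at hsp
  refine ⟨fun i => ∑ j, U j i • r j, hA.eigenvalues, fun i j => ?_, ?_⟩
  · have := congrFun (congrFun h2 i) j
    rw [Matrix.mul_apply, Matrix.one_apply] at this
    rw [← this, met_sum_left]
    refine sum_congr rfl fun k _ => ?_
    rw [met_smul_left, met_sum_right]
    simp [met_smul_right, hr _ _, Matrix.star_apply]
  · have h3 : star U * frameForm p B r * U = Matrix.diagonal hA.eigenvalues := by
      conv_lhs => rw [hsp]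
      simp only [Matrix.mul_assoc, h2, Matrix.mul_one]
      rw [← Matrix.mul_assoc, h2, Matrix.one_mul]
      rfl
    rw [← h3]
    ext i j
    rw [Matrix.mul_apply]
    simp only [frameForm, Matrix.of_apply, Matrix.mul_apply, map_sum, map_smul,
      _root_.sum_apply, _root_.smul_apply, smul_eq_mul, Finset.sum_div,
      Finset.sum_mul, Matrix.star_apply, star_trivial, Finset.mul_sum]
    exact sum_congr rfl fun a _ => sum_congr rfl fun b _ => by ring

theorem inv_firstForm (p : E n →L[ℝ] ℝ) : (firstForm p)⁻¹ = Matrix.of fun a b : Fin n =>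
    (if a = b then 1 else 0) - p (e a) * p (e b) / (1 + ‖p‖ ^ 2) := by
  have hw : (1 + ‖p‖ ^ 2) ≠ 0 := by positivity
  refine Matrix.inv_eq_left_inv ?_
  ext i j
  rw [Matrix.mul_apply, Matrix.one_apply]
  have hs : ∑ x, p (e i) * p (e x) / (1 + ‖p‖ ^ 2) * (p (e x) * p (e j))
      = p (e i) * p (e j) * ‖p‖ ^ 2 / (1 + ‖p‖ ^ 2) := by
    rw [norm_sq_eq_sum, Finset.mul_sum, Finset.sum_div]
    exact sum_congr rfl fun x _ => by ring
  simp only [firstForm, Matrix.of_apply, sub_mul, mul_add, sum_sub_distrib, sum_add_distrib, hs,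
    mul_ite, mul_one, mul_zero, sum_ite_eq, sum_ite_eq', Finset.mem_univ, if_true, ite_mul, one_mul,
    zero_mul]
  by_cases hij : i = j
  · simp [hij]; field_simp; ring
  · simp [hij]; field_simp; ring

theorem sum_frame_mul_frame (p : E n →L[ℝ] ℝ) {v : Fin n → E n} (hv : IsFrame p v) (a b : Fin n) :
    ∑ i, v i a * v i b = (if a = b then 1 else 0) - p (e a) * p (e b) / (1 + ‖p‖ ^ 2) := by
  have h' := congrFun (congrFun ((inv_firstForm_eq p hv).symm.trans (inv_firstForm p)) a) b
  simpa [Matrix.mul_apply, frameMatrix] using h'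

/-- Completeness of an orthonormal frame. -/
theorem sum_inner_smul_frame (p : E n →L[ℝ] ℝ) {v : Fin n → E n} (hv : IsFrame p v) (z : E n) :
    ∑ i, inner ℝ (v i) z • v i = z - (p z / (1 + ‖p‖ ^ 2)) • grad p := by
  ext a
  simp only [PiLp.inner_apply, WithLp.ofLp_sum, WithLp.ofLp_smul, WithLp.ofLp_sub, Finset.sum_apply,
    Pi.smul_apply, Pi.sub_apply, smul_eq_mul, grad_apply, Finset.sum_mul]
  rw [sum_comm]
  have : ∀ b, ∑ i, inner ℝ (v i b) (z b) * v i a = z b * ∑ i, v i b * v i a := by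
    intro b
    rw [Finset.mul_sum]
    refine sum_congr rfl fun i _ => ?_
    simp; ring
  simp only [this, sum_frame_mul_frame p hv]
  rw [apply_eq_sum p z]
  simp only [mul_sub, sum_sub_distrib, mul_ite, mul_one, mul_zero, sum_ite_eq', Finset.mem_univ, if_true,
    Finset.sum_div, Finset.sum_mul]
  congr 1
  exact sum_congr rfl fun b _ => by ring

theorem sum_inner_mul_inner_frame (p : E n →L[ℝ] ℝ) {v : Fin n → E n} (hv : IsFrame p v)
    (z y : E n) :
    ∑ i, inner ℝ (v i) z * inner ℝ (v i) y = inner ℝ z y - p z * p y / (1 + ‖p‖ ^ 2) := by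
  have := congrArg (fun x => inner ℝ x y) (sum_inner_smul_frame p hv z)
  simp only [sum_inner, real_inner_smul_left, inner_sub_left, inner_grad] at this
  rw [this]; ring

theorem sum_apply_smul_frame (p : E n →L[ℝ] ℝ) {v : Fin n → E n} (hv : IsFrame p v) :
    ∑ i, p (v i) • v i = (1 / (1 + ‖p‖ ^ 2)) • grad p := by
  have h := sum_inner_smul_frame p hv (grad p)
  simp only [real_inner_comm (grad p), inner_grad, apply_grad] at h
  have hw : (1 + ‖p‖ ^ 2) ≠ 0 := by positivity
  have e1 : (1 : ℝ) / (1 + ‖p‖ ^ 2) = 1 - ‖p‖ ^ 2 / (1 + ‖p‖ ^ 2) := by field_simp; ring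
  rw [e1, sub_smul, one_smul, ← h]

end CurvatureGraph

end

noncomputable section

namespace CurvatureGraph

open Filter Topology

/-! ### Iterated directional derivatives -/

section Directional

variable {F : Type*} [NormedAddCommGroup F] [NormedSpace ℝ F]

/-- The derivative of `f` in the direction `v`. -/
def dd (v : F) (f : F → ℝ) : F → ℝ := fun y => fderiv ℝ f y v

theorem contDiffAt_dd {f : F → ℝ} {x : F} {m k : ℕ} (hf : ContDiffAt ℝ k f x) (hm : m + 1 ≤ k)
    (v : F) : ContDiffAt ℝ m (dd v f) x :=
  (hf.fderiv_right (m := m) (by exact_mod_cast hm)).clm_apply contDiffAt_const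

theorem dd_congr {f g : F → ℝ} {x : F} (h : f =ᶠ[𝓝 x] g) (v : F) : dd v f =ᶠ[𝓝 x] dd v g := by
  filter_upwards [h.fderiv (𝕜 := ℝ)] with y hy
  rw [dd, hy, dd]

theorem dd_dd_apply {f : F → ℝ} {x : F} {k : ℕ} (hf : ContDiffAt ℝ k f x) (hk : 2 ≤ k) (v w : F) :
    dd v (dd w f) x = fderiv ℝ (fderiv ℝ f) x v w := by
  have h : DifferentiableAt ℝ (fderiv ℝ f) x :=
    (hf.fderiv_right (m := (1 : ℕ)) (by exact_mod_cast hk)).differentiableAt (by simp)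
  have : HasFDerivAt (dd w f) ((ContinuousLinearMap.apply ℝ ℝ w).comp (fderiv ℝ (fderiv ℝ f) x)) x :=
    (ContinuousLinearMap.apply ℝ ℝ w).hasFDerivAt.comp x h.hasFDerivAt
  rw [dd, this.fderiv]; rfl

theorem dd_comm {f : F → ℝ} {x : F} {k : ℕ} (hf : ContDiffAt ℝ k f x) (hk : 2 ≤ k) (v w : F) :
    dd v (dd w f) =ᶠ[𝓝 x] dd w (dd v f) := by
  filter_upwards [hf.eventually (by simp)] with y hy
  rw [dd_dd_apply hy hk, dd_dd_apply hy hk]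
  exact hy.isSymmSndFDerivAt (by simpa [minSmoothness] using (by exact_mod_cast hk : (2 : WithTop ℕ∞) ≤ k)) v w

theorem hasDerivAt_line {f : F → ℝ} {v : F} {t : ℝ} (hf : DifferentiableAt ℝ f (t • v)) :
    HasDerivAt (fun t : ℝ => f (t • v)) (dd v f (t • v)) t := by
  have h : HasDerivAt (fun t : ℝ => t • v) v t := by simpa using (hasDerivAt_id t).smul_const v
  exact hf.hasFDerivAt.comp_hasDerivAt t h

theorem isJet_line {f : F → ℝ} (hf : ContDiffAt ℝ 2 f 0) (v : F) :
    IsJet (fun t => f (t • v)) (f 0) (dd v f 0) (dd v (dd v f) 0) := by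
  have hl : Tendsto (fun t : ℝ => t • v) (𝓝 0) (𝓝 0) := by
    have : Continuous fun t : ℝ => t • v := by fun_prop
    simpa using this.tendsto 0
  refine ⟨by simp, fun t => dd v f (t • v), ?_, by simp, ?_⟩
  · filter_upwards [hl.eventually (hf.eventually (by simp))] with t ht
    exact hasDerivAt_line (ht.differentiableAt two_ne_zero)
  · have h1 : ContDiffAt ℝ (1 : ℕ) (dd v f) 0 := contDiffAt_dd (k := 2) hf le_rfl v
    have := hasDerivAt_line (f := dd v f) (v := v) (t := 0)
      (by rw [zero_smul]; exact h1.differentiableAt (by simp))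
    simpa using this

end Directional

variable {n : ℕ}

/-! ### The graph over the tangent plane -/

theorem IsFrame.sum_met_smul {p : E n →L[ℝ] ℝ} {v : Fin n → E n} (hv : IsFrame p v) (z : E n) :
    ∑ i, met p (v i) z • v i = z := by
  simp only [met, add_smul, Finset.sum_add_distrib]
  have h := sum_apply_smul_frame p hv
  have : ∑ i, (p (v i) * p z) • v i = p z • ∑ i, p (v i) • v i := by
    rw [Finset.smul_sum]
    exact Finset.sum_congr rfl fun i _ => by rw [smul_smul, mul_comm]
  rw [sum_inner_smul_frame p hv, this, h, smul_smul]
  simp [div_eq_mul_inv]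

/-- Linear coordinates with respect to a frame. -/
def frameEquiv {p : E n →L[ℝ] ℝ} {v : Fin n → E n} (hv : IsFrame p v) : E n ≃L[ℝ] E n :=
  ContinuousLinearEquiv.equivOfInverse
    (∑ i, (innerSL ℝ (v i) + p (v i) • p).smulRight (e i))
    (∑ i, (EuclideanSpace.proj i : E n →L[ℝ] ℝ).smulRight (v i))
    (fun z => by
      simp only [_root_.sum_apply, ContinuousLinearMap.smulRight_apply]
      conv_rhs => rw [← hv.sum_met_smul z]
      refine Finset.sum_congr rfl fun i _ => ?_
      congr 1
      simp [e, met])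
    (fun y => by
      conv_rhs => rw [eq_sum_smul_e y]
      simp only [_root_.sum_apply, ContinuousLinearMap.smulRight_apply]
      refine Finset.sum_congr rfl fun i _ => ?_
      congr 1
      have : (innerSL ℝ (v i) + p (v i) • p)
          (∑ j, (EuclideanSpace.proj j : E n →L[ℝ] ℝ) y • v j) = met p (v i) (∑ j, y j • v j) := rfl
      rw [this, met_sum_right]
      simp [met_smul_right, hv i _])

/-- Near the point over `x₀`, the graph of `g` is written as a graph over its tangent plane: `φ` is the
coordinate change, `L` an orthonormal basis of the tangent plane, and `c` the height. -/
structure TangentGraph (g : E n → ℝ) (x₀ : E n) (L : Fin n → E n) (φ : E n → E n) (c : E n → ℝ) :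
    Prop where
  contDiffAt_g : ContDiffAt ℝ (4 : ℕ) g x₀
  frame : IsFrame (fderiv ℝ g x₀) L
  contDiffAt_φ : ContDiffAt ℝ (4 : ℕ) φ 0
  contDiffAt_c : ContDiffAt ℝ (4 : ℕ) c 0
  φ_zero : φ 0 = x₀
  c_zero : c 0 = 0
  φ_eq : ∀ᶠ y in 𝓝 0, φ y = x₀ + ∑ i, y i • L i
    - (c y / √(1 + ‖fderiv ℝ g x₀‖ ^ 2)) • grad (fderiv ℝ g x₀)
  g_eq : ∀ᶠ y in 𝓝 0, g (φ y) = g x₀ + ∑ i, y i * fderiv ℝ g x₀ (L i)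
    + c y / √(1 + ‖fderiv ℝ g x₀‖ ^ 2)

/-- The tangential components of `(x - x₀, g x - g x₀)` in the basis `(Lᵢ, Dg(x₀)Lᵢ)` define a map
`Θ` with invertible derivative at `x₀`. Its local inverse is `φ`, and `c` is the component along the
normal at `x₀`. -/
theorem exists_tangentGraph {g : E n → ℝ} {x₀ : E n} (hg : ContDiffAt ℝ (4 : ℕ) g x₀)
    {L : Fin n → E n} (hL : IsFrame (fderiv ℝ g x₀) L) :
    ∃ φ c, TangentGraph g x₀ L φ c := by
  set p := fderiv ℝ g x₀ with hp
  set w := √(1 + ‖p‖ ^ 2) with hw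
  have hw0 : 0 < w := by positivity
  have hw2 : w ^ 2 = 1 + ‖p‖ ^ 2 := Real.sq_sqrt (by positivity)
  let Θ : E n → E n := fun x => ∑ i, (inner ℝ (L i) (x - x₀) + p (L i) * (g x - g x₀)) • e i
  have hΘ : ContDiffAt ℝ (4 : ℕ) Θ x₀ := by
    refine ContDiffAt.sum fun i _ => ContDiffAt.fun_smul ?_ contDiffAt_const
    exact (contDiffAt_const.inner ℝ (contDiffAt_id.sub contDiffAt_const)).add
      (contDiffAt_const.mul (hg.sub contDiffAt_const))
  have hgd : HasFDerivAt g p x₀ := (hg.differentiableAt (by simp)).hasFDerivAt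
  have hΘ' : HasFDerivAt Θ (frameEquiv hL : E n →L[ℝ] E n) x₀ := by
    have : HasFDerivAt Θ (∑ i, (innerSL ℝ (L i) + p (L i) • p).smulRight (e i)) x₀ := by
      refine HasFDerivAt.fun_sum fun i _ => HasFDerivAt.smul_const ?_ _
      refine HasFDerivAt.add ?_ ((hgd.sub_const (g x₀)).const_mul _)
      exact (innerSL ℝ (L i)).hasFDerivAt.comp x₀ ((hasFDerivAt_id x₀).sub_const x₀)
    exact this
  have hΘ0 : Θ x₀ = 0 := by simp [Θ]
  let φ := hΘ.localInverse hΘ' (by simp)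
  have hφ0 : φ 0 = x₀ := by rw [← hΘ0]; exact hΘ.localInverse_apply_image hΘ' (by simp)
  have hφc : ContDiffAt ℝ (4 : ℕ) φ 0 := by rw [← hΘ0]; exact hΘ.to_localInverse hΘ' (by simp)
  have hΘφ : ∀ᶠ y in 𝓝 0, Θ (φ y) = y := by
    have := (hΘ.hasStrictFDerivAt' hΘ' (by simp)).eventually_right_inverse
    rw [hΘ0] at this; exact this
  let c : E n → ℝ := fun y => (g (φ y) - g x₀ - p (φ y - x₀)) / w
  have hφeq : ∀ᶠ y in 𝓝 0, φ y = x₀ + ∑ i, y i • L i - (c y / w) • grad p := by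
    filter_upwards [hΘφ] with y hy
    have hyi : ∀ i, y i = inner ℝ (L i) (φ y - x₀) + p (L i) * (g (φ y) - g x₀) := by
      intro i
      conv_lhs => rw [← hy]
      simp [Θ, e, Finset.sum_apply, Pi.single_apply]
    have h1 := sum_inner_smul_frame p hL (φ y - x₀)
    have h2 := sum_apply_smul_frame p hL
    have : ∑ i, y i • L i = (φ y - x₀) + (c y / w) • grad p := by
      calc ∑ i, y i • L i = ∑ i, inner ℝ (L i) (φ y - x₀) • L i
            + (g (φ y) - g x₀) • ∑ i, p (L i) • L i := by
            rw [Finset.smul_sum, ← Finset.sum_add_distrib]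
            refine Finset.sum_congr rfl fun i _ => ?_
            rw [hyi i, add_smul, smul_smul, mul_comm (p (L i))]
        _ = _ := by
            rw [h1, h2, ← hw2]
            simp only [c]
            match_scalars <;> field_simp
            ring
    rw [this]; abel
  refine ⟨φ, c, hg, hL, hφc, ?_, hφ0, by simp [c, hφ0], hφeq, ?_⟩
  · have h1 : ContDiffAt ℝ (4 : ℕ) (fun y => g (φ y)) 0 := by
      have : ContDiffAt ℝ (4 : ℕ) g (φ 0) := by rwa [hφ0]
      exact this.comp 0 hφc
    exact ((h1.sub contDiffAt_const).sub
      (p.contDiff.contDiffAt.comp 0 (hφc.sub contDiffAt_const))).div_const w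
  · filter_upwards [hφeq] with y hy
    have h1 : p (φ y - x₀) = ∑ i, y i * p (L i) - c y / w * ‖p‖ ^ 2 := by
      have : φ y - x₀ = ∑ i, y i • L i - (c y / w) • grad p := by rw [hy]; abel
      rw [this]; simp [apply_grad]
    have h2 : g (φ y) = g x₀ + p (φ y - x₀) + w * c y := by simp only [c]; field_simp; ring
    change g (φ y) = g x₀ + ∑ i, y i * p (L i) + c y / w
    have h3 : c y / w * ‖p‖ ^ 2 = w * c y - c y / w := by
      rw [show ‖p‖ ^ 2 = w ^ 2 - 1 by linarith]; field_simp
    rw [h2, h1, h3]; ring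

namespace TangentGraph

variable {g : E n → ℝ} {x₀ : E n} {L : Fin n → E n} {φ : E n → E n} {c : E n → ℝ}

/-- The coordinate vector fields of a graph over the tangent plane, projected to the base. -/
def vec (g : E n → ℝ) (x₀ : E n) (L : Fin n → E n) (c : E n → ℝ) (i : Fin n) (y : E n) : E n :=
  L i - (dd (e i) c y / √(1 + ‖fderiv ℝ g x₀‖ ^ 2)) • grad (fderiv ℝ g x₀)

theorem sum_e_smul {V : Type*} [AddCommGroup V] [Module ℝ V] (i : Fin n) (f : Fin n → V) :
    ∑ j, (e i : E n) j • f j = f i := by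
  simp [e]

theorem eventually_differentiableAt (G : TangentGraph g x₀ L φ c) :
    ∀ᶠ y in 𝓝 0, DifferentiableAt ℝ c y := by
  filter_upwards [G.contDiffAt_c.eventually (by simp)] with y hy
  exact hy.differentiableAt (by simp)

theorem eventually_fderiv_φ (G : TangentGraph g x₀ L φ c) :
    ∀ᶠ y in 𝓝 0, ∀ i, fderiv ℝ φ y (e i) = vec g x₀ L c i y := by
  filter_upwards [G.φ_eq.eventually_nhds, G.eventually_differentiableAt] with y hy hc i
  rw [Filter.EventuallyEq.fderiv_eq hy]
  have h1 : HasFDerivAt (fun y : E n => ∑ i, y i • L i)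
      (∑ i, (EuclideanSpace.proj i : E n →L[ℝ] ℝ).smulRight (L i)) y := by
    refine HasFDerivAt.fun_sum fun i _ => ?_
    exact (EuclideanSpace.proj i : E n →L[ℝ] ℝ).hasFDerivAt.smul_const (L i)
  have h2 := ((hc.hasFDerivAt.mul_const (√(1 + ‖fderiv ℝ g x₀‖ ^ 2))⁻¹).smul_const
    (grad (fderiv ℝ g x₀)))
  have h3 := ((h1.const_add x₀).sub h2).fderiv
  simp only [div_eq_mul_inv]
  refine (congrArg (fun A => A (e i)) h3).trans ?_
  simp only [_root_.sub_apply, _root_.sum_apply, ContinuousLinearMap.smulRight_apply,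
    _root_.smul_apply, vec, dd, smul_eq_mul, div_eq_mul_inv]
  congr 1
  · exact sum_e_smul i L
  · rw [mul_comm]

theorem tendsto_φ (G : TangentGraph g x₀ L φ c) : Tendsto φ (𝓝 0) (𝓝 x₀) := by
  have := G.contDiffAt_φ.continuousAt
  rwa [ContinuousAt, G.φ_zero] at this

/-- The coordinate vector fields are tangent. -/
theorem eventually_fderiv_g (G : TangentGraph g x₀ L φ c) :
    ∀ᶠ y in 𝓝 0, ∀ i, fderiv ℝ g (φ y) (vec g x₀ L c i y) =
      fderiv ℝ g x₀ (L i) + dd (e i) c y / √(1 + ‖fderiv ℝ g x₀‖ ^ 2) := by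
  filter_upwards [G.g_eq.eventually_nhds, G.eventually_differentiableAt, G.eventually_fderiv_φ,
    G.tendsto_φ.eventually (G.contDiffAt_g.eventually (by simp)),
    G.contDiffAt_φ.eventually (by simp)] with y hy hc hφ hg hφd i
  rw [← hφ i]
  have h0 : fderiv ℝ (fun y => g (φ y)) y (e i) = fderiv ℝ g (φ y) (fderiv ℝ φ y (e i)) := by
    rw [fderiv_fun_comp y (hg.differentiableAt (by simp)) (hφd.differentiableAt (by simp))]; rfl
  rw [← h0, Filter.EventuallyEq.fderiv_eq hy]
  have h1 : HasFDerivAt (fun y : E n => ∑ i, y i * fderiv ℝ g x₀ (L i))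
      (∑ i, fderiv ℝ g x₀ (L i) • (EuclideanSpace.proj i : E n →L[ℝ] ℝ)) y := by
    refine HasFDerivAt.fun_sum fun i _ => ?_
    exact (EuclideanSpace.proj i : E n →L[ℝ] ℝ).hasFDerivAt.mul_const _
  have h2 := hc.hasFDerivAt.mul_const (√(1 + ‖fderiv ℝ g x₀‖ ^ 2))⁻¹
  have h3 := ((h1.const_add (g x₀)).add h2).fderiv
  simp only [div_eq_mul_inv]
  refine (congrArg (fun A => A (e i)) h3).trans ?_
  simp only [_root_.add_apply, _root_.sum_apply, _root_.smul_apply, dd, smul_eq_mul]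
  congr 1
  · have := sum_e_smul i fun j => fderiv ℝ g x₀ (L j)
    simp only [smul_eq_mul] at this
    rw [← this]
    exact Finset.sum_congr rfl fun j _ => mul_comm _ _
  · rw [mul_comm]

/-- The second fundamental form in the coordinate frame. -/
theorem eventually_fderiv_fderiv_g (G : TangentGraph g x₀ L φ c) :
    ∀ᶠ y in 𝓝 0, ∀ i j, fderiv ℝ (fderiv ℝ g) (φ y) (vec g x₀ L c j y) (vec g x₀ L c i y) =
      dd (e j) (dd (e i) c) y * ((1 + fderiv ℝ g (φ y) (grad (fderiv ℝ g x₀)))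
        / √(1 + ‖fderiv ℝ g x₀‖ ^ 2)) := by
  filter_upwards [G.eventually_fderiv_g.eventually_nhds, G.contDiffAt_c.eventually (by simp),
    G.eventually_fderiv_φ, G.tendsto_φ.eventually (G.contDiffAt_g.eventually (by simp)),
    G.contDiffAt_φ.eventually (by simp)] with y hy hc hφ hg hφd i j
  set w := √(1 + ‖fderiv ℝ g x₀‖ ^ 2)
  set P := grad (fderiv ℝ g x₀)
  have hci : HasFDerivAt (dd (e i) c) (fderiv ℝ (dd (e i) c) y) y :=
    ((contDiffAt_dd (m := 3) hc le_rfl (e i)).differentiableAt (by simp)).hasFDerivAt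
  have hdg : HasFDerivAt (fderiv ℝ g) (fderiv ℝ (fderiv ℝ g) (φ y)) (φ y) :=
    ((hg.fderiv_right (m := (3 : ℕ)) (by norm_cast)).differentiableAt (by simp)).hasFDerivAt
  have hv : HasFDerivAt (vec g x₀ L c i) (-(((w⁻¹ • fderiv ℝ (dd (e i) c) y)).smulRight P)) y := by
    have := ((hci.mul_const w⁻¹).smul_const P).const_sub (L i)
    simp only [← div_eq_mul_inv] at this
    exact this
  have h1 := ((hdg.comp y (hφd.differentiableAt (by simp)).hasFDerivAt).clm_apply hv).fderiv
  have h2 := ((hci.mul_const w⁻¹).const_add (fderiv ℝ g x₀ (L i))).fderiv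
  have h3 : (fun y => fderiv ℝ g (φ y) (vec g x₀ L c i y)) =ᶠ[𝓝 y]
      fun y => fderiv ℝ g x₀ (L i) + dd (e i) c y * w⁻¹ := by
    filter_upwards [hy] with z hz
    rw [hz i, div_eq_mul_inv]
  have h4 := h3.fderiv_eq (𝕜 := ℝ)
  -- Differentiating the tangency relation once more: the second derivative of `φ` is a multiple of
  -- `grad (fderiv ℝ g x₀)`, and moving it to the right gives the factor `1 + Dg(grad)`.
  have h5 := congrArg (fun A => A (e j)) ((h1.symm.trans h4).trans h2)
  simp only [_root_.add_apply, ContinuousLinearMap.comp_apply, _root_.neg_apply, map_neg,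
    ContinuousLinearMap.smulRight_apply, _root_.smul_apply, smul_eq_mul, map_smul,
    ContinuousLinearMap.flip_apply, hφ j, Function.comp] at h5
  have h6 : fderiv ℝ (dd (e i) c) y (e j) = dd (e j) (dd (e i) c) y := rfl
  rw [h6] at h5
  rw [div_eq_mul_inv]
  linarith

end TangentGraph

end CurvatureGraph

end

/-! ### Normal, metric and shape operator near the base point, in terms of the height -/

noncomputable section

namespace CurvatureGraph

open Filter Topology

variable {n : ℕ}

/-- The area element of the graph of `c`. -/
def area (c : E n → ℝ) (y : E n) : ℝ := √(1 + ∑ i, dd (e i) c y ^ 2)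

/-- A diagonal entry of the shape operator of the graph of `c` in an orthonormal frame obtained by
correcting the coordinate frame. -/
def diagEntry (c : E n → ℝ) (i : Fin n) (y : E n) : ℝ :=
  (area c y)⁻¹ * (dd (e i) (dd (e i) c) y
    - dd (e i) c y * (area c y * (1 + area c y))⁻¹
      * ∑ j, dd (e j) c y * (dd (e i) (dd (e j) c) y + dd (e j) (dd (e i) c) y)
    + dd (e i) c y * (area c y * (1 + area c y))⁻¹ * (dd (e i) c y * (area c y * (1 + area c y))⁻¹)
      * ∑ j, dd (e j) c y * ∑ k, dd (e k) c y * dd (e j) (dd (e k) c) y)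

theorem area_pos (c : E n → ℝ) (y : E n) : 0 < area c y := Real.sqrt_pos.2 (by positivity)

theorem area_sq (c : E n → ℝ) (y : E n) : area c y ^ 2 = 1 + ∑ i, dd (e i) c y ^ 2 :=
  Real.sq_sqrt (by positivity)

namespace TangentGraph

variable {g : E n → ℝ} {x₀ : E n} {L : Fin n → E n} {φ : E n → E n} {c : E n → ℝ}

theorem dd_zero (G : TangentGraph g x₀ L φ c) (i : Fin n) : dd (e i) c 0 = 0 := by
  have h := G.eventually_fderiv_g.self_of_nhds i
  rw [G.φ_zero, vec, map_sub, map_smul, apply_grad, smul_eq_mul] at h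
  set w := √(1 + ‖fderiv ℝ g x₀‖ ^ 2)
  have hw : 0 < w := by positivity
  have h2 : dd (e i) c 0 / w * (1 + ‖fderiv ℝ g x₀‖ ^ 2) = 0 := by linarith
  have h3 : (1 + ‖fderiv ℝ g x₀‖ ^ 2) ≠ 0 := by positivity
  have h4 := (mul_eq_zero.1 h2).resolve_right h3
  exact (div_eq_zero_iff.1 h4).resolve_right hw.ne'

theorem dd_dd_zero (G : TangentGraph g x₀ L φ c) {l : Fin n → ℝ}
    (hl : frameForm (fderiv ℝ g x₀) (fderiv ℝ (fderiv ℝ g) x₀) L = Matrix.diagonal l)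
    (i j : Fin n) : dd (e j) (dd (e i) c) 0 = if i = j then l j else 0 := by
  have h := G.eventually_fderiv_fderiv_g.self_of_nhds i j
  have hv : ∀ i, vec g x₀ L c i 0 = L i := fun i => by simp [vec, G.dd_zero]
  rw [G.φ_zero, hv, hv, apply_grad] at h
  have h2 := congrFun (congrFun hl j) i
  rw [frameForm, Matrix.of_apply, h] at h2
  set w := √(1 + ‖fderiv ℝ g x₀‖ ^ 2)
  have hw : 0 < w := by positivity
  have hw2 : 1 + ‖fderiv ℝ g x₀‖ ^ 2 = w ^ 2 := (Real.sq_sqrt (by positivity)).symm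
  rw [hw2] at h2
  have h3 : dd (e j) (dd (e i) c) 0 * (w ^ 2 / w) / w = dd (e j) (dd (e i) c) 0 := by field_simp
  rw [← h3, h2, Matrix.diagonal_apply]
  by_cases hij : i = j
  · simp [hij]
  · simp [hij, Ne.symm hij]

/-- The normal of the graph in terms of the height over the tangent plane. -/
theorem eventually_normal (G : TangentGraph g x₀ L φ c) :
    ∀ᶠ y in 𝓝 0, 0 < 1 + fderiv ℝ g (φ y) (grad (fderiv ℝ g x₀)) ∧
      (1 + fderiv ℝ g (φ y) (grad (fderiv ℝ g x₀))) * area c y =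
        √(1 + ‖fderiv ℝ g x₀‖ ^ 2) * √(1 + ‖fderiv ℝ g (φ y)‖ ^ 2) ∧
      1 / √(1 + ‖fderiv ℝ g (φ y)‖ ^ 2) = (area c y)⁻¹ *
        (1 / √(1 + ‖fderiv ℝ g x₀‖ ^ 2) - ∑ i, dd (e i) c y * fderiv ℝ g x₀ (L i)) := by
  have hcont : ContinuousAt (fun y => 1 + fderiv ℝ g (φ y) (grad (fderiv ℝ g x₀))) 0 := by
    have h1 : ContinuousAt (fderiv ℝ g) (φ 0) := by
      rw [G.φ_zero]
      exact (G.contDiffAt_g.fderiv_right (m := (3 : ℕ)) (by norm_cast)).continuousAt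
    exact continuousAt_const.add ((h1.comp G.contDiffAt_φ.continuousAt).clm_apply continuousAt_const)
  have hpos := hcont.eventually (lt_mem_nhds (a := 0) (by
    simp only [G.φ_zero, apply_grad]; positivity))
  filter_upwards [hpos, G.eventually_fderiv_g] with y hs ht
  set p := fderiv ℝ g x₀
  set pc := fderiv ℝ g (φ y)
  set s := 1 + pc (grad p) with hsdef
  set w := √(1 + ‖p‖ ^ 2)
  set wy := √(1 + ‖pc‖ ^ 2)
  have hw : 0 < w := by positivity
  have hwy : 0 < wy := by positivity
  have hw2 : w ^ 2 = 1 + ‖p‖ ^ 2 := Real.sq_sqrt (by positivity)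
  have hwy2 : wy ^ 2 = 1 + ‖pc‖ ^ 2 := Real.sq_sqrt (by positivity)
  have hA := area_pos c y
  have hA2 := area_sq c y
  have hL : ∀ i, inner ℝ (L i) (grad pc - grad p) = dd (e i) c y * s / w := by
    intro i
    have h := ht i
    rw [vec, map_sub, map_smul, smul_eq_mul] at h
    rw [inner_sub_right, real_inner_comm, inner_grad, real_inner_comm, inner_grad]
    have e1 : dd (e i) c y * s / w = dd (e i) c y / w + dd (e i) c y / w * pc (grad p) := by
      rw [hsdef]; ring
    rw [e1]; linarith
  have hpz : p (grad pc - grad p) = s - w ^ 2 := by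
    rw [map_sub, apply_grad, ← inner_grad p (grad pc), real_inner_comm, inner_grad, hw2, hsdef]
    ring
  have hzz : inner ℝ (grad pc - grad p) (grad pc - grad p) = wy ^ 2 - 2 * s + w ^ 2 := by
    rw [real_inner_self_eq_norm_sq, norm_sub_sq_real, inner_grad, norm_grad, norm_grad, hwy2, hw2,
      hsdef]
    ring
  have h1 := sum_inner_mul_inner_frame p G.frame (grad pc - grad p) (grad pc - grad p)
  rw [hpz, hzz, ← hw2] at h1
  simp only [hL] at h1
  have h1' : ∑ i, dd (e i) c y * s / w * (dd (e i) c y * s / w)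
      = s ^ 2 / w ^ 2 * ∑ i, dd (e i) c y ^ 2 := by
    rw [Finset.mul_sum]; exact Finset.sum_congr rfl fun i _ => by ring
  rw [h1'] at h1
  -- `s/(w wy)` is the inner product of the unit normals at the two points, which should equal
  -- `1/area`. Completeness of the frame yields the squared identity; positivity of `s` selects the
  -- root.
  have hsq : (s * area c y) ^ 2 = (w * wy) ^ 2 := by
    rw [mul_pow, hA2]
    field_simp at h1
    nlinarith
  have hsA : s * area c y = w * wy := by
    rwa [sq_eq_sq₀ (by positivity) (by positivity)] at hsq
  refine ⟨hs, hsA, ?_⟩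
  have h2 := congrArg (fun x => inner ℝ x (grad pc - grad p)) (sum_apply_smul_frame p G.frame)
  simp only [sum_inner, real_inner_smul_left, inner_grad, hL, hpz, ← hw2] at h2
  have h2' : ∑ i, p (L i) * (dd (e i) c y * s / w) = s / w * ∑ i, dd (e i) c y * p (L i) := by
    rw [Finset.mul_sum]; exact Finset.sum_congr rfl fun i _ => by ring
  rw [h2'] at h2
  set Q := ∑ i, dd (e i) c y * p (L i)
  have h3 : s * Q = (s - w ^ 2) / w := by
    field_simp at h2 ⊢
    linarith
  have hAeq : (area c y)⁻¹ = s / (w * wy) := by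
    rw [← hsA]; field_simp
  rw [hAeq]
  have h4 : s / (w * wy) * (1 / w - Q) = (s / w - s * Q) / (w * wy) := by ring
  rw [h4, h3]
  field_simp
  ring

/-- The metric in the coordinate frame. -/
theorem eventually_met (G : TangentGraph g x₀ L φ c) :
    ∀ᶠ y in 𝓝 0, ∀ i j, met (fderiv ℝ g (φ y)) (vec g x₀ L c i y) (vec g x₀ L c j y)
      = (if i = j then 1 else 0) + dd (e i) c y * dd (e j) c y := by
  filter_upwards [G.eventually_fderiv_g] with y ht i j
  rw [met, ht, ht, ← G.frame i j, met, vec, vec]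
  set p := fderiv ℝ g x₀
  set w := √(1 + ‖p‖ ^ 2)
  have hw : 0 < w := by positivity
  have hw2 : w ^ 2 = 1 + ‖p‖ ^ 2 := Real.sq_sqrt (by positivity)
  have e1 : ∀ v : E n, inner ℝ v (grad p) = p v := fun v => by rw [real_inner_comm, inner_grad]
  simp only [inner_sub_left, inner_sub_right, real_inner_smul_left, real_inner_smul_right, e1,
    inner_grad, map_smul, smul_eq_mul, apply_grad, show ‖p‖ ^ 2 = w ^ 2 - 1 by linarith]
  field_simp
  ring

/-- Near the base point the shape operator has the diagonal entries `diagEntry c i` in a suitable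
orthonormal frame. -/
theorem eventually_diagEntry (G : TangentGraph g x₀ L φ c) :
    ∀ᶠ y in 𝓝 0, ∃ r : Fin n → E n, IsFrame (fderiv ℝ g (φ y)) r ∧
      ∀ i, frameForm (fderiv ℝ g (φ y)) (fderiv ℝ (fderiv ℝ g) (φ y)) r i i = diagEntry c i y := by
  filter_upwards [G.eventually_met, G.eventually_normal, G.eventually_fderiv_fderiv_g]
    with y hm ⟨hs, hsA, _⟩ hB
  refine ⟨_, IsFrame.correct hm (area_pos c y) (area_sq c y), fun i => ?_⟩
  set p := fderiv ℝ g x₀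
  set pc := fderiv ℝ g (φ y)
  set B := fderiv ℝ (fderiv ℝ g) (φ y)
  set s := 1 + pc (grad p)
  set w := √(1 + ‖p‖ ^ 2)
  set wy := √(1 + ‖pc‖ ^ 2)
  have hw : 0 < w := by positivity
  have hwy : 0 < wy := by positivity
  have hA := area_pos c y
  -- The factor `s/w` from the second derivative of `g` and the normalization `1/wy` combine to
  -- `1/area`, the usual factor for the graph of `c`.
  have hAeq : (area c y)⁻¹ = s / w / wy := by
    rw [div_div, ← hsA]; field_simp
  set t := dd (e i) c y / (area c y * (1 + area c y)) with ht
  set u := ∑ j, dd (e j) c y • vec g x₀ L c j y with hu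
  have b1 : ∀ k, B (vec g x₀ L c k y) u = s / w * ∑ j, dd (e j) c y * dd (e k) (dd (e j) c) y := by
    intro k
    rw [hu, map_sum, Finset.mul_sum]
    refine Finset.sum_congr rfl fun j _ => ?_
    rw [map_smul, smul_eq_mul, hB]; ring
  have b2 : B u (vec g x₀ L c i y) = s / w * ∑ j, dd (e j) c y * dd (e j) (dd (e i) c) y := by
    rw [hu, map_sum, _root_.sum_apply, Finset.mul_sum]
    refine Finset.sum_congr rfl fun j _ => ?_
    rw [map_smul, _root_.smul_apply, smul_eq_mul, hB]; ring
  have b3 : B u u = s / w * ∑ j, dd (e j) c y * ∑ k, dd (e k) c y * dd (e j) (dd (e k) c) y := by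
    have : B u = ∑ j, dd (e j) c y • B (vec g x₀ L c j y) := by
      rw [hu, map_sum]; simp only [map_smul]
    rw [this, _root_.sum_apply, Finset.mul_sum]
    refine Finset.sum_congr rfl fun j _ => ?_
    rw [_root_.smul_apply, smul_eq_mul, b1]; ring
  have b4 : frameForm pc B (fun i => vec g x₀ L c i y
      + (-(dd (e i) c y / (area c y * (1 + area c y)))) • u) i i
      = B (vec g x₀ L c i y + (-t) • u) (vec g x₀ L c i y + (-t) • u) / wy := rfl
  have b5 : B (vec g x₀ L c i y + (-t) • u) = B (vec g x₀ L c i y) + (-t) • B u := by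
    rw [map_add, map_smul]
  rw [b4, b5, _root_.add_apply, _root_.smul_apply, map_add, map_add, map_smul,
    map_smul, b1, b2, b3, hB, diagEntry, ← div_eq_mul_inv, ← ht, hAeq]
  simp only [smul_eq_mul, mul_add, Finset.sum_add_distrib]
  ring

end TangentGraph

end CurvatureGraph

end

/-! ### Second order expansions along the coordinate axes of the tangent plane -/

noncomputable section

namespace CurvatureGraph

open Filter Topology

variable {n : ℕ}

theorem dd_eventually_congr {f h : E n → ℝ} (hfh : f =ᶠ[𝓝 0] h) (v : E n) : dd v f 0 = dd v h 0 :=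
  (dd_congr hfh v).eq_of_nhds

theorem isJet_comp_line {F : Type*} [NormedAddCommGroup F] [NormedSpace ℝ F] {H : F → ℝ} {z X ν : F}
    (hH : ContDiffAt ℝ 2 H z) {u : ℝ → ℝ} {m : ℝ} (hu : IsJet u 0 0 m) :
    IsJet (fun t => H (z + t • X + u t • ν)) (H z) (fderiv ℝ H z X)
      (fderiv ℝ (fderiv ℝ H) z X X + m * fderiv ℝ H z ν) := by
  have huc := hu.continuousAt
  obtain ⟨h0, u', h1, h2, h3⟩ := hu
  have hγ : Tendsto (fun t => z + t • X + u t • ν) (𝓝 0) (𝓝 z) := by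
    have : ContinuousAt (fun t => z + t • X + u t • ν) 0 := by fun_prop
    simpa [ContinuousAt, h0] using this
  have hd : ∀ t, HasDerivAt u (u' t) t →
      HasDerivAt (fun t => z + t • X + u t • ν) (X + u' t • ν) t := fun t ht => by
    have := (((hasDerivAt_id t).smul_const X).const_add z).fun_add (ht.smul_const ν)
    simpa using this
  refine ⟨by simp [h0], fun t => fderiv ℝ H (z + t • X + u t • ν) (X + u' t • ν), ?_,
    by simp [h0, h2], ?_⟩
  · filter_upwards [h1, hγ.eventually (hH.eventually (by simp))] with t ht hHt
    exact (hHt.differentiableAt two_ne_zero).hasFDerivAt.comp_hasDerivAt t (hd t ht)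
  · have e0 : z + (0 : ℝ) • X + u 0 • ν = z := by simp [h0]
    have hHd : HasFDerivAt (fderiv ℝ H) (fderiv ℝ (fderiv ℝ H) z) (z + (0 : ℝ) • X + u 0 • ν) := by
      rw [e0]
      exact ((hH.fderiv_right (m := 1) (by norm_num)).differentiableAt one_ne_zero).hasFDerivAt
    have h4 := hHd.comp_hasDerivAt 0 (hd 0 h1.self_of_nhds)
    have h5 := h4.clm_apply ((h3.smul_const ν).const_add X)
    refine h5.congr_deriv ?_
    simp [h0, h2]

/-- The jets of the slope, of the diagonal entries of the shape operator and of the normal component of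
a graph over its tangent plane, in the direction `e j`. -/
theorem jets_of_height {c : E n → ℝ} (hc : ContDiffAt ℝ (4 : ℕ) c 0) {l : Fin n → ℝ}
    (h1 : ∀ i, dd (e i) c 0 = 0) (h2 : ∀ i j, dd (e j) (dd (e i) c) 0 = if i = j then l j else 0)
    (ε : Fin n → ℝ) (τ : ℝ) (j : Fin n) :
    (∀ i, IsJet (fun t => diagEntry c i (t • e j)) (l i) (dd (e j) (dd (e i) (dd (e i) c)) 0)
      (dd (e j) (dd (e j) (dd (e i) (dd (e i) c))) 0 - l i * l j ^ 2
        - 2 * (if i = j then l j ^ 3 else 0))) ∧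
    IsJet (fun t => (area c (t • e j))⁻¹ * (τ - ∑ i, dd (e i) c (t • e j) * ε i)) τ
      (-(l j * ε j))
      (-(l j ^ 2 * τ) - ∑ m, dd (e m) (dd (e j) (dd (e j) c)) 0 * ε m) := by
  have c3 : ∀ v, ContDiffAt ℝ (3 : ℕ) (dd v c) 0 := fun v => contDiffAt_dd hc le_rfl v
  have c2 : ∀ v w, ContDiffAt ℝ (2 : ℕ) (dd w (dd v c)) 0 := fun v w => contDiffAt_dd (c3 v) le_rfl w
  have J1 : ∀ i, IsJet (fun t => dd (e i) c (t • e j)) 0 (if i = j then l j else 0)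
      (dd (e i) (dd (e j) (dd (e j) c)) 0) := by
    intro i
    refine (isJet_line ((c3 (e i)).of_le (by norm_cast)) (e j)).congr_val (h1 i) (h2 i j) ?_
    rw [dd_eventually_congr (dd_comm hc (by norm_num) (e j) (e i)),
      (dd_comm (c3 (e j)) (by norm_num) (e j) (e i)).eq_of_nhds]
  have J2 : ∀ i k, IsJet (fun t => dd (e k) (dd (e i) c) (t • e j)) (if i = k then l k else 0)
      (dd (e j) (dd (e k) (dd (e i) c)) 0) (dd (e j) (dd (e j) (dd (e k) (dd (e i) c))) 0) :=
    fun i k => (isJet_line (c2 (e i) (e k)) (e j)).congr_val (h2 i k) rfl rfl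
  have Jq : IsJet (fun t => ∑ i, dd (e i) c (t • e j) ^ 2) 0 0 (2 * l j ^ 2) := by
    have := IsJet.sum Finset.univ fun i (_ : i ∈ Finset.univ) => (J1 i).mul (J1 i)
    simp only [← pow_two] at this
    refine this.congr_val (by simp) (by simp) ?_
    simp [ite_pow]
  have JW : IsJet (fun t => area c (t • e j)) 1 0 (l j ^ 2) :=
    (((IsJet.const 1).add Jq).sqrt (by norm_num)).congr_val (by simp) (by simp) (by simp)
  have JWi : IsJet (fun t => (area c (t • e j))⁻¹) 1 0 (-l j ^ 2) :=
    (JW.inv one_ne_zero).congr_val (by simp) (by simp) (by simp)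
  have Js := (JW.mul ((IsJet.const 1).add JW)).inv (by norm_num)
  refine ⟨fun i => ?_, ?_⟩
  -- The two factors of the first frame correction vanish at `0`, so only their first derivatives
  -- `λⱼ/2` and `2λⱼ²` (for `i = j`) matter; their product contributes `2λⱼ³`. The term `-λᵢλⱼ²`
  -- comes from `1/area`.
  · have Jt : ∃ m, IsJet (fun t => dd (e i) c (t • e j) *
        (area c (t • e j) * (1 + area c (t • e j)))⁻¹) 0 ((if i = j then l j else 0) / 2) m :=
      ⟨_, ((J1 i).mul Js).congr_val (by simp) (by norm_num; split_ifs <;> ring) rfl⟩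
    obtain ⟨m, Jt⟩ := Jt
    have JX : ∃ m, IsJet (fun t => ∑ k, dd (e k) c (t • e j) *
        (dd (e i) (dd (e k) c) (t • e j) + dd (e k) (dd (e i) c) (t • e j))) 0
        (2 * if i = j then l j ^ 2 else 0) m := by
      refine ⟨_, (IsJet.sum Finset.univ fun k (_ : k ∈ Finset.univ) =>
        (J1 k).mul ((J2 k i).add (J2 i k))).congr_val (by simp) ?_ rfl⟩
      by_cases hij : i = j
      · subst hij; simp; ring
      · simp [hij, Ne.symm hij]
    obtain ⟨m', JX⟩ := JX
    -- The last correction is a product of three factors vanishing at `0` and has no second order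
    -- part, so its jet need not be computed.
    have JZ : ∃ a b, IsJet (fun t => ∑ k, dd (e k) c (t • e j) *
        ∑ k', dd (e k') c (t • e j) * dd (e k) (dd (e k') c) (t • e j)) 0 a b :=
      ⟨_, _, (IsJet.sum Finset.univ fun k (_ : k ∈ Finset.univ) => (J1 k).mul
        (IsJet.sum Finset.univ fun k' (_ : k' ∈ Finset.univ) =>
          (J1 k').mul (J2 k' k))).congr_val (by simp) rfl rfl⟩
    obtain ⟨z1, z2, JZ⟩ := JZ
    refine (JWi.mul (((J2 i i).sub (Jt.mul JX)).add ((Jt.mul Jt).mul JZ))).congr_val ?_ ?_ ?_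
    · simp
    · simp
    · by_cases hij : i = j
      · subst hij; simp; ring
      · simp [hij]; ring
  · have Jsum := IsJet.sum Finset.univ fun i (_ : i ∈ Finset.univ) => (J1 i).mul (IsJet.const (ε i))
    refine (JWi.mul ((IsJet.const τ).sub Jsum)).congr_val ?_ ?_ ?_
    · simp
    · simp
    · simp; ring

/-- The local picture at a point of a graph. -/
theorem exists_graphJets {g : E n → ℝ} {x₀ : E n} (hg : ContDiffAt ℝ (4 : ℕ) g x₀)
    {H : E n × ℝ → ℝ} (hH : ContDiffAt ℝ 2 H (x₀, g x₀)) (hH0 : 0 < H (x₀, g x₀)) {K : ℝ}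
    (hK1 : ‖fderiv ℝ H (x₀, g x₀)‖ ≤ K) (hK2 : ‖fderiv ℝ (fderiv ℝ H) (x₀, g x₀)‖ ≤ K) :
    ∃ (L : Fin n → E n) (l η ε : Fin n → ℝ) (T N : Fin n → Fin n → ℝ) (θ : ℝ) (ζ : Fin n → ℝ)
      (ψ : Fin n → ℝ → E n) (d : Fin n → Fin n → ℝ → ℝ) (tau : Fin n → ℝ → ℝ),
      GraphJets l η ε T N (1 / √(1 + ‖fderiv ℝ g x₀‖ ^ 2)) (H (x₀, g x₀)) θ ζ d tau
        (fun j t => H (ψ j t, g (ψ j t))) ∧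
      IsFrame (fderiv ℝ g x₀) L ∧
      frameForm (fderiv ℝ g x₀) (fderiv ℝ (fderiv ℝ g) x₀) L = Matrix.diagonal l ∧
      (∀ i, |ε i| ≤ 1) ∧ (∀ i, |η i| ≤ K) ∧ (∀ i, |ζ i| ≤ K) ∧ |θ| ≤ K ∧
      (∀ j, Tendsto (ψ j) (𝓝 0) (𝓝 x₀)) ∧
      ∀ j, ∀ᶠ t in 𝓝 0, tau j t = 1 / √(1 + ‖fderiv ℝ g (ψ j t)‖ ^ 2) ∧
        ∃ r : Fin n → E n, IsFrame (fderiv ℝ g (ψ j t)) r ∧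
          ∀ i, frameForm (fderiv ℝ g (ψ j t)) (fderiv ℝ (fderiv ℝ g) (ψ j t)) r i i = d j i t := by
  have hsym : ∀ u v, fderiv ℝ (fderiv ℝ g) x₀ u v = fderiv ℝ (fderiv ℝ g) x₀ v u :=
    fun u v => (hg.isSymmSndFDerivAt (by simp; norm_cast)) u v
  obtain ⟨L, l, hL, hl⟩ := exists_frame (fderiv ℝ g x₀) hsym
  obtain ⟨φ, c, G⟩ := exists_tangentGraph hg hL
  set p := fderiv ℝ g x₀ with hp
  set w := √(1 + ‖p‖ ^ 2) with hw
  have hw0 : 0 < w := by positivity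
  have hw2 : w ^ 2 = 1 + ‖p‖ ^ 2 := Real.sq_sqrt (by positivity)
  have hc := G.contDiffAt_c
  set z₀ : E n × ℝ := (x₀, g x₀) with hz
  let X : Fin n → E n × ℝ := fun j => (L j, p (L j))
  let ν : E n × ℝ := (-(w⁻¹ • grad p), w⁻¹)
  have hLL : ∀ i, ‖L i‖ ^ 2 + p (L i) ^ 2 = 1 := fun i => by
    have := hL i i
    rw [met, real_inner_self_eq_norm_sq, if_pos rfl] at this
    rw [← this]; ring
  have hp1 : ∀ i, |p (L i)| ≤ 1 := fun i => by
    rw [← sq_le_one_iff_abs_le_one]; nlinarith [hLL i, sq_nonneg ‖L i‖]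
  have hX : ∀ i, ‖X i‖ ≤ 1 := fun i => by
    rw [Prod.norm_def]
    refine max_le ?_ (hp1 i)
    have := hLL i
    nlinarith [norm_nonneg (L i), sq_nonneg (p (L i))]
  have hν : ‖ν‖ ≤ 1 := by
    have hw1 : 1 ≤ w := by nlinarith [sq_nonneg ‖p‖]
    have hpw : ‖p‖ ≤ w := by nlinarith [norm_nonneg p]
    rw [Prod.norm_def]
    refine max_le ?_ ?_
    · simp only [ν, norm_neg, norm_smul, norm_inv, Real.norm_eq_abs, abs_of_pos hw0, norm_grad]
      rw [inv_mul_le_iff₀ hw0]; linarith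
    · simp only [ν, norm_inv, Real.norm_eq_abs, abs_of_pos hw0]
      exact inv_le_one_of_one_le₀ hw1
  have hK0 : 0 ≤ K := (norm_nonneg _).trans hK1
  have hop1 : ∀ v : E n × ℝ, ‖v‖ ≤ 1 → |fderiv ℝ H z₀ v| ≤ K := fun v hv => by
    have := (fderiv ℝ H z₀).le_opNorm v
    rw [Real.norm_eq_abs] at this
    exact this.trans ((mul_le_of_le_one_right (norm_nonneg _) hv).trans hK1)
  have hop2 : ∀ v : E n × ℝ, ‖v‖ ≤ 1 → |fderiv ℝ (fderiv ℝ H) z₀ v v| ≤ K := fun v hv => by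
    have := (fderiv ℝ (fderiv ℝ H) z₀).le_opNorm₂ v v
    rw [Real.norm_eq_abs] at this
    have h2 : ‖v‖ * ‖v‖ ≤ 1 := mul_le_one₀ hv (norm_nonneg v) hv
    rw [mul_assoc] at this
    exact this.trans ((mul_le_of_le_one_right (norm_nonneg (fderiv ℝ (fderiv ℝ H) z₀)) h2).trans hK2)
  have hline : ∀ j : Fin n, Tendsto (fun t : ℝ => t • (e j : E n)) (𝓝 0) (𝓝 0) := fun j => by
    have : Continuous fun t : ℝ => t • (e j : E n) := by fun_prop
    simpa using this.tendsto 0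
  have J := jets_of_height hc G.dd_zero (G.dd_dd_zero hl) (fun i => p (L i)) (1 / w)
  refine ⟨L, l, fun j => fderiv ℝ H z₀ (X j), fun i => p (L i),
    fun i j => dd (e j) (dd (e i) (dd (e i) c)) 0,
    fun i j => dd (e j) (dd (e j) (dd (e i) (dd (e i) c))) 0, fderiv ℝ H z₀ ν,
    fun j => fderiv ℝ (fderiv ℝ H) z₀ (X j) (X j), fun j t => φ (t • e j),
    fun j i t => diagEntry c i (t • e j),
    fun j t => (area c (t • e j))⁻¹ * (1 / w - ∑ i, dd (e i) c (t • e j) * p (L i)),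
    ⟨fun i j => ?_, by positivity, hH0, fun j i => (J j).1 i, fun j => (J j).2, fun j => ?_⟩,
    hL, hl, hp1, fun i => hop1 _ (hX i), fun i => hop2 _ (hX i), hop1 _ hν, fun j => ?_, fun j => ?_⟩
  · have c3 : ∀ v, ContDiffAt ℝ (3 : ℕ) (dd v c) 0 := fun v => contDiffAt_dd hc le_rfl v
    have c2 : ∀ v w, ContDiffAt ℝ (2 : ℕ) (dd w (dd v c)) 0 :=
      fun v w => contDiffAt_dd (c3 v) le_rfl w
    -- The coordinates on the tangent plane are flat, so the fourth derivatives commute; all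
    -- curvature terms sit in the explicit formula for the diagonal entries.
    calc dd (e j) (dd (e j) (dd (e i) (dd (e i) c))) 0
        = dd (e j) (dd (e i) (dd (e j) (dd (e i) c))) 0 :=
          dd_eventually_congr (dd_comm (c3 (e i)) (by norm_num) (e j) (e i)) _
      _ = dd (e j) (dd (e i) (dd (e i) (dd (e j) c))) 0 :=
          dd_eventually_congr (dd_congr (dd_comm hc (by norm_num) (e j) (e i)) _) _
      _ = dd (e i) (dd (e j) (dd (e i) (dd (e j) c))) 0 :=
          (dd_comm (c2 (e j) (e i)) le_rfl (e j) (e i)).eq_of_nhds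
      _ = dd (e i) (dd (e i) (dd (e j) (dd (e j) c))) 0 :=
          dd_eventually_congr (dd_comm (c3 (e j)) (by norm_num) (e j) (e i)) _
  · have Jc : IsJet (fun t => c (t • e j)) 0 0 (l j) :=
      (isJet_line (hc.of_le (by norm_cast)) (e j)).congr_val G.c_zero (G.dd_zero j)
        (by rw [G.dd_dd_zero hl, if_pos rfl])
    have := isJet_comp_line (X := X j) (ν := ν) hH Jc
    refine this.congr ?_
    filter_upwards [(hline j).eventually G.φ_eq, (hline j).eventually G.g_eq] with t ht1 ht2
    have es1 : ∑ i, (t • (e j : E n)) i • L i = t • L j := by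
      have := TangentGraph.sum_e_smul j fun i => L i
      simp only [PiLp.smul_apply, smul_assoc, ← Finset.smul_sum, this]
    have es2 : ∑ i, (t • (e j : E n)) i * p (L i) = t * p (L j) := by
      have := TangentGraph.sum_e_smul j fun i => p (L i)
      simp only [PiLp.smul_apply, smul_eq_mul, mul_assoc, ← Finset.mul_sum] at this ⊢
      rw [this]
    congr 1
    rw [Prod.ext_iff]
    constructor
    · simp only [ht1, es1, hz, X, ν, Prod.fst_add, Prod.smul_fst, smul_neg, smul_smul,
        ← div_eq_mul_inv, ← sub_eq_add_neg]
      rfl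
    · simp only [ht2, hz, X, ν, Prod.snd_add, Prod.smul_snd, smul_eq_mul, ← div_eq_mul_inv]
      rw [← es2]
  · have := G.tendsto_φ.comp (hline j)
    exact this
  · filter_upwards [(hline j).eventually G.eventually_normal,
      (hline j).eventually G.eventually_diagEntry] with t ht1 ht2
    exact ⟨ht1.2.2.symm, ht2⟩

end CurvatureGraph

end

/-! ### Continuity of the curvature quantities, and the local picture for a solution -/

noncomputable section

namespace CurvatureGraph

open Filter Topology

variable {n : ℕ}

theorem continuous_shapeOperator :
    Continuous fun q : (E n →L[ℝ] ℝ) × (E n →L[ℝ] E n →L[ℝ] ℝ) => shapeOperator q.1 q.2 := by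
  have hp : ∀ i : Fin n, Continuous fun q : (E n →L[ℝ] ℝ) × (E n →L[ℝ] E n →L[ℝ] ℝ) =>
      q.1 (e i) := fun i => by fun_prop
  have hB : ∀ i j : Fin n, Continuous fun q : (E n →L[ℝ] ℝ) × (E n →L[ℝ] E n →L[ℝ] ℝ) =>
      q.2 (e i) (e j) := fun i j => by fun_prop
  have hn : Continuous fun q : (E n →L[ℝ] ℝ) × (E n →L[ℝ] E n →L[ℝ] ℝ) => 1 + ‖q.1‖ ^ 2 := by
    fun_prop
  refine continuous_matrix fun i j => ?_
  simp only [shapeOperator, inv_firstForm, Matrix.mul_apply, Matrix.of_apply, secondForm]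
  refine continuous_finsetSum _ fun a _ => Continuous.mul ?_ ?_
  · exact continuous_const.sub (((hp i).mul (hp a)).div hn fun q => by positivity)
  · exact (hB a j).div hn.sqrt fun q => (Real.sqrt_pos.2 (by positivity)).ne'

theorem continuous_trace_shapeOperator :
    Continuous fun q : (E n →L[ℝ] ℝ) × (E n →L[ℝ] E n →L[ℝ] ℝ) => (shapeOperator q.1 q.2).trace :=
  continuous_shapeOperator.matrix_trace

theorem continuous_normA :
    Continuous fun q : (E n →L[ℝ] ℝ) × (E n →L[ℝ] E n →L[ℝ] ℝ) => normA q.1 q.2 :=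
  (continuous_shapeOperator.matrix_mul continuous_shapeOperator).matrix_trace.sqrt

theorem normA_nonneg (p : E n →L[ℝ] ℝ) (B : E n →L[ℝ] E n →L[ℝ] ℝ) : 0 ≤ normA p B :=
  Real.sqrt_nonneg _

/-- With `a = 1 + |Dg|²`, this puts the right side of the equation into the form `H τ^q` of the
pointwise inequalities. -/
theorem div_rpow_eq (h a q : ℝ) (ha : 0 < a) : h / a ^ (q / 2) = h * (1 / √a) ^ q := by
  rw [one_div, Real.inv_rpow (Real.sqrt_nonneg a), Real.sqrt_eq_rpow, ← Real.rpow_mul ha.le,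
    div_eq_mul_inv]
  congr 3
  ring

theorem inGamma_map_iff {k : ℕ} {l : Fin n → ℝ} {S : Multiset ℝ}
    (hS : ∀ m, S.esymm m = es Finset.univ m l) : InGamma k S ↔ Gam Finset.univ k l := by
  refine ⟨fun h m hm => ?_, fun h m _ hm => ?_⟩
  · rcases Nat.eq_zero_or_pos m with rfl | h0
    · rw [es_zero]; exact one_pos
    · rw [← hS]; exact h m h0 hm
  · rw [hS]; exact h m hm

/-- The local picture at a point of the graph of an admissible solution. -/
theorem exists_jets_of_solution {Ω : Set (E n)} {H : E n × ℝ → ℝ} {g : E n → ℝ}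
    {Dg : E n → E n →L[ℝ] ℝ} {D2g : E n → E n →L[ℝ] E n →L[ℝ] ℝ} {M h₀ K : ℝ} (hh₀ : 0 < h₀)
    (hΩ : IsOpen Ω) (hg : ContDiffOn ℝ 4 g Ω) (hC2 : IsC2OnClosure Ω g Dg D2g)
    (hH : ContDiffOn ℝ 2 H (Ω ×ˢ univ))
    (hB : BoundsOn h₀ K H (Ω ×ˢ Icc (sInf (g '' Ω)) (sSup (g '' Ω))))
    (hM : ∀ x ∈ Ω, |g x| ≤ M ∧ ‖Dg x‖ ≤ M) {z : E n} (hz : z ∈ Ω) :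
    ∃ (l η ε : Fin n → ℝ) (T N : Fin n → Fin n → ℝ) (θ : ℝ) (ζ : Fin n → ℝ)
      (ψ : Fin n → ℝ → E n) (d : Fin n → Fin n → ℝ → ℝ) (tau : Fin n → ℝ → ℝ),
      GraphJets l η ε T N (1 / √(1 + ‖Dg z‖ ^ 2)) (H (z, g z)) θ ζ d tau
        (fun j t => H (ψ j t, g (ψ j t))) ∧
      GraphJets.Bounds (1 / √(1 + M ^ 2)) h₀ K η ε ζ (1 / √(1 + ‖Dg z‖ ^ 2)) (H (z, g z)) θ ∧
      (∀ m, (principalCurvatures (Dg z) (D2g z)).esymm m = es Finset.univ m l) ∧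
      normA (Dg z) (D2g z) = √(∑ i, l i ^ 2) ∧
      (shapeOperator (Dg z) (D2g z)).trace = ∑ i, l i ∧
      ∀ j, ∀ᶠ t in 𝓝 0, ψ j t ∈ Ω ∧ tau j t = 1 / √(1 + ‖Dg (ψ j t)‖ ^ 2) ∧
        (shapeOperator (Dg (ψ j t)) (D2g (ψ j t))).trace = ∑ i, d j i t ∧
        ∑ i, d j i t ^ 2 ≤ normA (Dg (ψ j t)) (D2g (ψ j t)) ^ 2 ∧
        (principalCurvatures (Dg (ψ j t)) (D2g (ψ j t))).esymm 1 = ∑ i, d j i t ∧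
        ∀ m, InGamma m (principalCurvatures (Dg (ψ j t)) (D2g (ψ j t))) →
          (principalCurvatures (Dg (ψ j t)) (D2g (ψ j t))).esymm m
            ≤ es Finset.univ m fun i => d j i t := by
  have hgx : ∀ x ∈ Ω, ContDiffAt ℝ (4 : ℕ) g x := fun x hx => by
    exact_mod_cast hg.contDiffAt (hΩ.mem_nhds hx)
  have hsym : ∀ x ∈ Ω, ∀ u v, fderiv ℝ (fderiv ℝ g) x u v = fderiv ℝ (fderiv ℝ g) x v u :=
    fun x hx u v => ((hgx x hx).isSymmSndFDerivAt (by simp; norm_cast)) u v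
  have hHz : ContDiffAt ℝ 2 H (z, g z) :=
    hH.contDiffAt ((hΩ.prod isOpen_univ).mem_nhds ⟨hz, mem_univ _⟩)
  have hbdd : BddAbove (g '' Ω) ∧ BddBelow (g '' Ω) := by
    refine ⟨⟨M, ?_⟩, ⟨-M, ?_⟩⟩
    · rintro _ ⟨x, hx, rfl⟩; exact (le_abs_self _).trans (hM x hx).1
    · rintro _ ⟨x, hx, rfl⟩; exact (abs_le.1 (hM x hx).1).1
  obtain ⟨hge, hj⟩ := hB (z, g z) ⟨hz, csInf_le hbdd.2 ⟨z, hz, rfl⟩, le_csSup hbdd.1 ⟨z, hz, rfl⟩⟩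
  have hK0 : H (z, g z) ≤ K := by
    have := hj 0 (by norm_num)
    rw [norm_iteratedFDeriv_zero] at this
    exact (le_abs_self _).trans this
  have hK1 : ‖fderiv ℝ H (z, g z)‖ ≤ K := by
    have := hj 1 (by norm_num)
    rwa [← norm_iteratedFDeriv_fderiv, norm_iteratedFDeriv_zero] at this
  have hK2 : ‖fderiv ℝ (fderiv ℝ H) (z, g z)‖ ≤ K := by
    have := hj 2 le_rfl
    rwa [← norm_iteratedFDeriv_fderiv, ← norm_iteratedFDeriv_fderiv, norm_iteratedFDeriv_zero] at this
  obtain ⟨L, l, η, ε, T, N, θ, ζ, ψ, d, tau, G, hL, hl, hε, hη, hζ, hθ, hψ, hev⟩ :=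
    exists_graphJets (hgx z hz) hHz (hh₀.trans_le hge) hK1 hK2
  have eD := hC2.eqOn_D
  have eD2 := hC2.eqOn_D2
  have hMz := (hM z hz).2
  rw [← eD hz] at G hL hl
  rw [← eD2 hz] at hl
  refine ⟨l, η, ε, T, N, θ, ζ, ψ, d, tau, G, ⟨?_, ?_, hge, hK0, hε, hη, hζ, hθ⟩, fun m => ?_, ?_, ?_,
    fun j => ?_⟩
  · refine one_div_le_one_div_of_le (by positivity) (Real.sqrt_le_sqrt ?_)
    have := pow_le_pow_left₀ (norm_nonneg _) hMz 2
    linarith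
  · rw [div_le_one (by positivity)]
    exact Real.one_le_sqrt.2 (by nlinarith [sq_nonneg ‖Dg z‖])
  · rw [principalCurvatures_of_diagonal _ hL hl, Finset.esymm_map_val]; rfl
  · rw [← Real.sqrt_sq (normA_nonneg _ _), normA_sq _ (by rw [eD2 hz]; exact hsym z hz) hL, hl]
    simp [Matrix.diagonal_apply, ite_pow]
  · rw [trace_shapeOperator _ _ hL, hl, Matrix.trace_diagonal]
  · filter_upwards [hev j, (hψ j).eventually (hΩ.mem_nhds hz)] with t ⟨h1, r, hr, hd⟩ hmem
    rw [← eD hmem] at h1 hr hd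
    rw [← eD2 hmem] at hd
    have hBs : ∀ u v, D2g (ψ j t) u v = D2g (ψ j t) v u := by
      rw [eD2 hmem]; exact hsym _ hmem
    have hA := frameForm_isHermitian (Dg (ψ j t)) hBs r
    have hdiag : (frameForm (Dg (ψ j t)) (D2g (ψ j t)) r).diag = fun i => d j i t := funext hd
    have htr : (shapeOperator (Dg (ψ j t)) (D2g (ψ j t))).trace = ∑ i, d j i t := by
      rw [trace_shapeOperator _ _ hr, Matrix.trace, hdiag]
    refine ⟨hmem, h1, htr, ?_, ?_, fun m hm => ?_⟩
    -- Away from the base point the frame need not be principal, and dropping the off-diagonal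
    -- squares gives only an inequality. Its direction suits the maximum condition.
    · rw [normA_sq _ hBs hr]
      refine Finset.sum_le_sum fun i _ => ?_
      rw [← hd i]
      exact Finset.single_le_sum (f := fun j' => frameForm (Dg (ψ j t)) (D2g (ψ j t)) r i j' ^ 2)
        (fun _ _ => sq_nonneg _) (Finset.mem_univ i)
    · rw [esymm_principalCurvatures _ hBs hr, es_one, ← htr, trace_shapeOperator _ _ hr,
        hA.trace_eq_sum_eigenvalues]
      simp
    · rw [inGamma_map_iff (esymm_principalCurvatures _ hBs hr)] at hm
      rw [esymm_principalCurvatures _ hBs hr, ← hdiag]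
      exact (es_eigenvalues_le_es_diag hA hm).2

/-- `(∑ λᵢ)² - ∑ λᵢ² = 2σ₂`, which is positive on `Γ₂`. -/
theorem sum_sq_le_sq_sum {l : Fin n → ℝ} (h : Gam Finset.univ 2 l) :
    √(∑ i, l i ^ 2) ≤ ∑ i, l i := by
  have h1 := h 1 (by norm_num)
  have h2 := h 2 le_rfl
  rw [es_one] at h1
  refine Real.sqrt_le_iff.2 ⟨h1.le, ?_⟩
  have h3 := sum_mul_es_erase Finset.univ 1 l
  have h4 : ∀ i, es (Finset.univ.erase i) 1 l = ∑ j, l j - l i := fun i => by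
    rw [es_one, ← Finset.add_sum_erase _ _ (Finset.mem_univ i)]; ring
  simp only [h4, mul_sub, Finset.sum_sub_distrib, ← Finset.sum_mul, ← pow_two] at h3
  norm_num at h3
  linarith

/-! ### Maximum principle on the closure of the domain -/

section Estimate

variable {Ω : Set (E n)} {H : E n × ℝ → ℝ} {g : E n → ℝ} {Dg : E n → E n →L[ℝ] ℝ}
  {D2g : E n → E n →L[ℝ] E n →L[ℝ] ℝ} {M h₀ K q : ℝ}

theorem continuousOn_jet (hC2 : IsC2OnClosure Ω g Dg D2g) :
    ContinuousOn (fun x => (Dg x, D2g x)) (closure Ω) :=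
  hC2.continuousOn_D.prodMk hC2.continuousOn_D2

theorem continuousOn_trace_shapeOperator (hC2 : IsC2OnClosure Ω g Dg D2g) :
    ContinuousOn (fun x => (shapeOperator (Dg x) (D2g x)).trace) (closure Ω) := by
  have h := continuous_trace_shapeOperator.comp_continuousOn (continuousOn_jet hC2)
  exact h

theorem continuousOn_normA (hC2 : IsC2OnClosure Ω g Dg D2g) :
    ContinuousOn (fun x => normA (Dg x) (D2g x)) (closure Ω) := by
  have h := continuous_normA.comp_continuousOn (continuousOn_jet hC2)
  exact h

theorem norm_le_on_closure (hC2 : IsC2OnClosure Ω g Dg D2g)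
    (hM : ∀ x ∈ Ω, |g x| ≤ M ∧ ‖Dg x‖ ≤ M) {x : E n} (hx : x ∈ closure Ω) : ‖Dg x‖ ≤ M :=
  le_on_closure (fun y hy => (hM y hy).2) hC2.continuousOn_D.norm continuousOn_const hx

theorem normA_le_trace_of_two_le {k : ℕ} (hk : 2 ≤ k) (hh₀ : 0 < h₀) (hΩ : IsOpen Ω)
    (hg : ContDiffOn ℝ 4 g Ω) (hC2 : IsC2OnClosure Ω g Dg D2g) (hH : ContDiffOn ℝ 2 H (Ω ×ˢ univ))
    (hB : BoundsOn h₀ K H (Ω ×ˢ Icc (sInf (g '' Ω)) (sSup (g '' Ω))))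
    (hM : ∀ x ∈ Ω, |g x| ≤ M ∧ ‖Dg x‖ ≤ M) (hsol : IsAdmissibleSolution k q Ω H g Dg D2g)
    {x : E n} (hx : x ∈ Ω) :
    normA (Dg x) (D2g x) ≤ (shapeOperator (Dg x) (D2g x)).trace ∧
      (shapeOperator (Dg x) (D2g x)).trace ≤ n * normA (Dg x) (D2g x) := by
  obtain ⟨l, η, ε, T, N, θ, ζ, ψ, d, tau, G, hb, hes, hA, ht, hev⟩ :=
    exists_jets_of_solution hh₀ hΩ hg hC2 hH hB hM hx
  have hG := (inGamma_map_iff hes).1 (hsol x hx).1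
  rw [hA, ht]
  exact ⟨sum_sq_le_sq_sum (hG.mono hk), (le_abs_self _).trans
    (GraphJets.abs_sum_le (GraphJets.abs_le_sqrt_sum l))⟩

/-- `z` maximizes `σ₁ √(1+|Dg|²)` over the compact closure. Interior `z` gives the first alternative
through the pointwise bound, and frontier `z` the second. The comparison `σ₁ ≤ n|A|` passes to the
frontier by continuity; `|A| ≤ σ₁` is needed only inside. -/
theorem exists_estimate_of_two_le (n k : ℕ) {q : ℝ} (M : ℝ) {h₀ : ℝ} (K : ℝ) (hk : 2 ≤ k)
    (hq : q ≤ 1) (hh₀ : 0 < h₀) :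
    ∃ C : ℝ, 0 ≤ C ∧ ∀ (Ω : Set (E n)) (H : E n × ℝ → ℝ) (g : E n → ℝ) (Dg : E n → E n →L[ℝ] ℝ)
      (D2g : E n → E n →L[ℝ] E n →L[ℝ] ℝ), IsOpen Ω → Ω.Nonempty → Bornology.IsBounded Ω →
      ContDiffOn ℝ 4 g Ω → IsC2OnClosure Ω g Dg D2g → ContDiffOn ℝ 2 H (Ω ×ˢ univ) →
      BoundsOn h₀ K H (Ω ×ˢ Icc (sInf (g '' Ω)) (sSup (g '' Ω))) →
      (∀ x ∈ Ω, |g x| ≤ M ∧ ‖Dg x‖ ≤ M) → IsAdmissibleSolution k q Ω H g Dg D2g →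
      ∃ z ∈ closure Ω, ∀ x ∈ Ω, normA (Dg x) (D2g x) ≤ C ∨
        z ∈ frontier Ω ∧ normA (Dg x) (D2g x) ≤ C * normA (Dg z) (D2g z) := by
  have hτ₀ : 0 < 1 / √(1 + M ^ 2) := by positivity
  obtain ⟨C₁, hC₁⟩ := GraphJets.exists_bound_of_two_le n k K hk hq hτ₀ hh₀
  refine ⟨n * max 1 C₁ * √(1 + M ^ 2), by positivity, ?_⟩
  intro Ω H g Dg D2g hΩ hne hbd hg hC2 hH hB hM hsol
  let Q : E n → ℝ := fun x => (shapeOperator (Dg x) (D2g x)).trace / (1 / √(1 + ‖Dg x‖ ^ 2))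
  have hQ : ContinuousOn Q (closure Ω) := by
    refine (continuousOn_trace_shapeOperator hC2).div ?_ ?_
    · refine continuousOn_const.div ?_ fun x _ => (by positivity)
      exact (continuousOn_const.add (hC2.continuousOn_D.norm.pow 2)).sqrt
    · intro x _; positivity
  obtain ⟨z, hz, hmax⟩ := hbd.isCompact_closure.exists_isMaxOn hne.closure hQ
  have hwx : ∀ x, Q x = (shapeOperator (Dg x) (D2g x)).trace * √(1 + ‖Dg x‖ ^ 2) := fun x => by
    simp [Q]
  have hwM : ∀ x ∈ closure Ω, √(1 + ‖Dg x‖ ^ 2) ≤ √(1 + M ^ 2) := fun x hx => by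
    refine Real.sqrt_le_sqrt ?_
    have := pow_le_pow_left₀ (norm_nonneg _) (norm_le_on_closure hC2 hM hx) 2
    linarith
  have htr := fun x hx => normA_le_trace_of_two_le (x := x) hk hh₀ hΩ hg hC2 hH hB hM hsol hx
  have htr' : ∀ x ∈ closure Ω, (shapeOperator (Dg x) (D2g x)).trace ≤ n * normA (Dg x) (D2g x) := by
    have h := continuousOn_const (c := (n : ℝ)).mul (continuousOn_normA hC2)
    exact fun x hx => le_on_closure (fun y hy => (htr y hy).2)
      (continuousOn_trace_shapeOperator hC2) h hx
  have hAQ : ∀ x ∈ Ω, normA (Dg x) (D2g x) ≤ Q z := by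
    intro x hx
    refine le_trans ?_ (hmax (subset_closure hx))
    have h1 : 1 ≤ √(1 + ‖Dg x‖ ^ 2) := Real.one_le_sqrt.2 (by nlinarith [sq_nonneg ‖Dg x‖])
    rw [hwx]
    have h2 := htr x hx
    exact h2.1.trans (le_mul_of_one_le_right ((normA_nonneg _ _).trans h2.1) h1)
  have hQz : Q z ≤ n * normA (Dg z) (D2g z) * √(1 + M ^ 2) := by
    rw [hwx]
    exact mul_le_mul (htr' z hz) (hwM z hz) (by positivity)
      (mul_nonneg (Nat.cast_nonneg n) (normA_nonneg _ _))
  refine ⟨z, hz, fun x hx => ?_⟩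
  by_cases hzΩ : z ∈ Ω
  · left
    obtain ⟨l, η, ε, T, N, θ, ζ, ψ, d, tau, G, hb, hes, hA, ht, hev⟩ :=
      exists_jets_of_solution hh₀ hΩ hg hC2 hH hB hM hzΩ
    have hG := (inGamma_map_iff hes).1 (hsol z hzΩ).1
    have hsz := (hsol z hzΩ).2
    rw [hes, div_rpow_eq _ _ _ (by positivity)] at hsz
    have hbound := hC₁ l η ε T N _ _ θ ζ d tau _ G hb hG hsz (fun j => ?_) (fun j => ?_)
    · rw [← hA] at hbound
      refine (hAQ x hx).trans (hQz.trans ?_)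
      exact mul_le_mul_of_nonneg_right (mul_le_mul_of_nonneg_left
        (hbound.trans (le_max_right _ _)) (Nat.cast_nonneg n)) (by positivity)
    · filter_upwards [hev j] with t ⟨h1, h2, h3, h4, h5, h6⟩
      obtain ⟨s1, s2⟩ := hsol _ h1
      -- The equation holds for the eigenvalues at the nearby point; Schur's inequality transfers
      -- it, one-sided, to the diagonal entries.
      rw [h2, ← div_rpow_eq _ _ _ (by positivity), ← s2]
      exact h6 k s1
    · filter_upwards [hev j] with t ⟨h1, h2, h3, h4, h5, h6⟩
      rw [h2, ← h3, ← ht]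
      exact hmax (subset_closure h1)
  · right
    refine ⟨⟨hz, by rwa [hΩ.interior_eq]⟩, (hAQ x hx).trans (hQz.trans ?_)⟩
    calc n * normA (Dg z) (D2g z) * √(1 + M ^ 2)
        = n * 1 * √(1 + M ^ 2) * normA (Dg z) (D2g z) := by ring
      _ ≤ _ := by
        have := normA_nonneg (Dg z) (D2g z)
        gcongr
        exact le_max_left _ _

/-- Here `z` maximizes `|A|²/(τ - τ₀/2)²`. Since `τ - τ₀/2` lies between `τ₀/2` and `1`, passing
from the value at `z` to `|A|` elsewhere costs only the factor `1/(τ₀/2)`. -/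
theorem exists_estimate_of_one (n : ℕ) (q M : ℝ) {h₀ : ℝ} (K : ℝ) (hh₀ : 0 < h₀) :
    ∃ C : ℝ, 0 ≤ C ∧ ∀ (Ω : Set (E n)) (H : E n × ℝ → ℝ) (g : E n → ℝ) (Dg : E n → E n →L[ℝ] ℝ)
      (D2g : E n → E n →L[ℝ] E n →L[ℝ] ℝ), IsOpen Ω → Ω.Nonempty → Bornology.IsBounded Ω →
      ContDiffOn ℝ 4 g Ω → IsC2OnClosure Ω g Dg D2g → ContDiffOn ℝ 2 H (Ω ×ˢ univ) →
      BoundsOn h₀ K H (Ω ×ˢ Icc (sInf (g '' Ω)) (sSup (g '' Ω))) →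
      (∀ x ∈ Ω, |g x| ≤ M ∧ ‖Dg x‖ ≤ M) → IsAdmissibleSolution 1 q Ω H g Dg D2g →
      ∃ z ∈ closure Ω, ∀ x ∈ Ω, normA (Dg x) (D2g x) ≤ C ∨
        z ∈ frontier Ω ∧ normA (Dg x) (D2g x) ≤ C * normA (Dg z) (D2g z) := by
  set τ₀ : ℝ := 1 / √(1 + M ^ 2) with hτ₀
  have hτ₀pos : 0 < τ₀ := by positivity
  obtain ⟨C₁, hC₁⟩ := GraphJets.exists_bound_of_one n q (τ₀ := τ₀) K hτ₀pos hh₀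
  refine ⟨max 1 C₁ / (τ₀ / 2), by positivity, ?_⟩
  intro Ω H g Dg D2g hΩ hne hbd hg hC2 hH hB hM hsol
  let Q : E n → ℝ := fun x => normA (Dg x) (D2g x) ^ 2 / (1 / √(1 + ‖Dg x‖ ^ 2) - τ₀ / 2) ^ 2
  have hτ : ∀ x ∈ closure Ω, τ₀ / 2 ≤ 1 / √(1 + ‖Dg x‖ ^ 2) - τ₀ / 2 := fun x hx => by
    have h1 : τ₀ ≤ 1 / √(1 + ‖Dg x‖ ^ 2) := by
      refine one_div_le_one_div_of_le (by positivity) (Real.sqrt_le_sqrt ?_)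
      have := pow_le_pow_left₀ (norm_nonneg _) (norm_le_on_closure hC2 hM hx) 2
      linarith
    linarith
  have hQ : ContinuousOn Q (closure Ω) := by
    refine ((continuousOn_normA hC2).pow 2).div ?_ ?_
    · refine ((continuousOn_const.div ?_ fun x _ => (by positivity)).sub continuousOn_const).pow 2
      exact (continuousOn_const.add (hC2.continuousOn_D.norm.pow 2)).sqrt
    · intro x hx
      have := hτ x hx
      exact pow_ne_zero 2 (by linarith)
  obtain ⟨z, hz, hmax⟩ := hbd.isCompact_closure.exists_isMaxOn hne.closure hQ
  have hAQ : ∀ x ∈ Ω, normA (Dg x) (D2g x) ≤ normA (Dg z) (D2g z) / (τ₀ / 2) := by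
    intro x hx
    have h1 : Q x ≤ Q z := hmax (subset_closure hx)
    have h2 := hτ x (subset_closure hx)
    have h3 := hτ z hz
    have h4 : 1 / √(1 + ‖Dg x‖ ^ 2) ≤ 1 := by
      rw [div_le_one (by positivity)]
      exact Real.one_le_sqrt.2 (by nlinarith [sq_nonneg ‖Dg x‖])
    simp only [Q, ← div_pow] at h1
    have h5 := (sq_le_sq₀ (div_nonneg (normA_nonneg _ _) (by linarith))
      (div_nonneg (normA_nonneg _ _) (by linarith))).1 h1
    calc normA (Dg x) (D2g x) ≤ normA (Dg x) (D2g x) / (1 / √(1 + ‖Dg x‖ ^ 2) - τ₀ / 2) :=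
          le_div_self (normA_nonneg _ _) (by linarith) (by linarith)
      _ ≤ _ := h5
      _ ≤ _ := div_le_div_of_nonneg_left (normA_nonneg _ _) (by positivity) h3
  refine ⟨z, hz, fun x hx => ?_⟩
  by_cases hzΩ : z ∈ Ω
  · left
    obtain ⟨l, η, ε, T, N, θ, ζ, ψ, d, tau, G, hb, hes, hA, ht, hev⟩ :=
      exists_jets_of_solution hh₀ hΩ hg hC2 hH hB hM hzΩ
    have hsz := (hsol z hzΩ).2
    rw [hes, es_one, div_rpow_eq _ _ _ (by positivity)] at hsz
    have hbound := hC₁ l η ε T N _ _ θ ζ d tau _ G hb hsz (fun j => ?_) (fun j => ?_)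
    · rw [← hA] at hbound
      refine (hAQ x hx).trans (div_le_div_of_nonneg_right (hbound.trans (le_max_right _ _)) ?_)
      positivity
    · filter_upwards [hev j] with t ⟨h1, h2, h3, h4, h5, h6⟩
      rw [h2, ← div_rpow_eq _ _ _ (by positivity), ← (hsol _ h1).2, h5]
    · filter_upwards [hev j] with t ⟨h1, h2, h3, h4, h5, h6⟩
      have h7 : Q (ψ j t) ≤ Q z := hmax (subset_closure h1)
      have h8 : ∑ i, l i ^ 2 = normA (Dg z) (D2g z) ^ 2 := by
        rw [hA, Real.sq_sqrt (Finset.sum_nonneg fun i _ => sq_nonneg _)]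
      rw [h8, h2]
      exact (div_le_div_of_nonneg_right h4 (sq_nonneg _)).trans h7
  · right
    refine ⟨⟨hz, by rwa [hΩ.interior_eq]⟩, (hAQ x hx).trans ?_⟩
    rw [div_mul_eq_mul_div]
    refine div_le_div_of_nonneg_right ?_ (by positivity)
    exact le_mul_of_one_le_left (normA_nonneg _ _) (le_max_left _ _)

end Estimate

end CurvatureGraph

end

theorem theorem1p2 (n k : ℕ) (hk : 1 ≤ k) (hkn : k ≤ n) (q : ℝ) (hq : q ≤ 1)
    (M h₀ K : ℝ) (hh₀ : 0 < h₀) :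
    ∃ C : ℝ, ∀ (Ω : Set (CurvatureGraph.E n)) (H : CurvatureGraph.E n × ℝ → ℝ)
      (g : CurvatureGraph.E n → ℝ)
      (Dg : CurvatureGraph.E n → CurvatureGraph.E n →L[ℝ] ℝ)
      (D2g : CurvatureGraph.E n → CurvatureGraph.E n →L[ℝ] CurvatureGraph.E n →L[ℝ] ℝ),
      IsOpen Ω → Ω.Nonempty → Bornology.IsBounded Ω →
      ContDiffOn ℝ 4 g Ω → CurvatureGraph.IsC2OnClosure Ω g Dg D2g →
      ContDiffOn ℝ 2 H (Ω ×ˢ univ) →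
      CurvatureGraph.BoundsOn h₀ K H (Ω ×ˢ Icc (sInf (g '' Ω)) (sSup (g '' Ω))) →
      (∀ x ∈ Ω, |g x| ≤ M ∧ ‖Dg x‖ ≤ M) →
      CurvatureGraph.IsAdmissibleSolution k q Ω H g Dg D2g →
      BddAbove ((fun x => CurvatureGraph.normA (Dg x) (D2g x)) '' Ω) ∧
      BddAbove ((fun x => CurvatureGraph.normA (Dg x) (D2g x)) '' frontier Ω) ∧
      sSup ((fun x => CurvatureGraph.normA (Dg x) (D2g x)) '' Ω)
        ≤ C * (1 + sSup ((fun x => CurvatureGraph.normA (Dg x) (D2g x)) '' frontier Ω)) := by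
  open CurvatureGraph in
  have key : ∃ C : ℝ, 0 ≤ C ∧ ∀ (Ω : Set (E n)) (H : E n × ℝ → ℝ) (g : E n → ℝ)
      (Dg : E n → E n →L[ℝ] ℝ) (D2g : E n → E n →L[ℝ] E n →L[ℝ] ℝ),
      IsOpen Ω → Ω.Nonempty → Bornology.IsBounded Ω →
      ContDiffOn ℝ 4 g Ω → IsC2OnClosure Ω g Dg D2g → ContDiffOn ℝ 2 H (Ω ×ˢ univ) →
      BoundsOn h₀ K H (Ω ×ˢ Icc (sInf (g '' Ω)) (sSup (g '' Ω))) →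
      (∀ x ∈ Ω, |g x| ≤ M ∧ ‖Dg x‖ ≤ M) → IsAdmissibleSolution k q Ω H g Dg D2g →
      ∃ z ∈ closure Ω, ∀ x ∈ Ω, normA (Dg x) (D2g x) ≤ C ∨
        z ∈ frontier Ω ∧ normA (Dg x) (D2g x) ≤ C * normA (Dg z) (D2g z) := by
    rcases Nat.lt_or_ge k 2 with h | h
    · obtain rfl : k = 1 := by omega
      exact exists_estimate_of_one n q M K hh₀
    · exact exists_estimate_of_two_le n k M K h hq hh₀
  obtain ⟨C, hC, hmain⟩ := key
  refine ⟨C, ?_⟩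
  intro Ω H g Dg D2g hΩ hne hbd hg hC2 hH hB hM hsol
  obtain ⟨z, hz, hzx⟩ := hmain Ω H g Dg D2g hΩ hne hbd hg hC2 hH hB hM hsol
  have hbA : BddAbove ((fun x => CurvatureGraph.normA (Dg x) (D2g x)) '' closure Ω) :=
    (hbd.isCompact_closure.image_of_continuousOn
      (CurvatureGraph.continuous_normA.comp_continuousOn
        (CurvatureGraph.continuousOn_jet hC2))).bddAbove
  have hb1 := hbA.mono (image_mono subset_closure)
  have hb2 := hbA.mono (image_mono (frontier_subset_closure (s := Ω)))
  refine ⟨hb1, hb2, csSup_le (hne.image _) ?_⟩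
  rintro _ ⟨x, hx, rfl⟩
  -- `Real.sSup_nonneg` also covers an empty frontier, where the supremum takes the default value
  -- `0`.
  have hs0 : 0 ≤ sSup ((fun x => CurvatureGraph.normA (Dg x) (D2g x)) '' frontier Ω) := by
    refine Real.sSup_nonneg ?_
    rintro _ ⟨y, _, rfl⟩
    exact CurvatureGraph.normA_nonneg _ _
  rcases hzx x hx with h | ⟨hzf, h⟩
  · exact h.trans (le_mul_of_one_le_right hC (by linarith))
  · refine h.trans (mul_le_mul_of_nonneg_left ?_ hC)
    have := le_csSup hb2 ⟨z, hzf, rfl⟩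
    linarith
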